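/- **MPC.** An MPC protocol for $n$-edge inputs has finitely many machines, words from an alphabet of size $W\ge n$, and a bound $s$ on the local memory (in words) of a machine. Initially the input edges $(u_t,v_t)$, $t<n$, with $u_t,v_t\in\{0,\dots,n-1\}$, are stored on the machines, edge $t$ on a prescribed machine, as two words. In each round every machine computes an arbitrary function of its local memory and sends messages to the others; its new local memory consists of the messages it receives. No machine may ever hold, send or receive more than $s$ words in a round. After $R$ rounds a designated machine outputs a bit. The protocol *distinguishes cycles* if, within its memory bound and for every list of the edges (in any order and orientation, each edge once) of a graph on $\{0,\dots,n-1\}$, it outputs $1$ when the graph is a cycle of length $n$ and $0$ when it is the disjoint union of two cycles of length $n/2$. **One-cycle versus two-cycle conjecture.** For every $\delta\in(0,1)$ and $\gamma\in\mathbb N$: if $(P_n)_n$ are MPC protocols with local memory $O(n^\delta)$, with $O(n^\gamma)$ machines and $W=O(n^\gamma)$ (i.e. words of $O(\log n)$ bits), and $P_n$ distinguishes cycles for every even $n\ge 6$, then $P_n$ uses $\Omega(\log n)$ rounds as $n\to\infty$ along even $n$. **Transformers.** $p$-bit numbers are $z/2^p$ with $z\in\mathbb Z$, $|z|\le 2^{2p}$;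 $\mathrm{rd}$ is rounding to the nearest one (clamping if out of range). A transformer of depth $L$ and width $m$ with $H$ heads per layer on $T$ tokens maps $X=(X_i)_{i<T}$, $X_i$ a vector of $m$ such numbers, through $L$ layers $$X_i\mapsto \psi_{i}\Big(\mathrm{rd}\big(X_i+\textstyle\sum_{h}f_{h}(X)_i\big)\Big),\qquad f_h(X)_i=\mathrm{rd}\Big(\frac{\sum_j w_{ij}v_j}{\sum_j w_{ij}}\Big),\quad w_{ij}=\mathrm{rd}\big(\exp(q_i\cdot k_j-\max_l q_i\cdot k_l)\big),$$ where $q_i=Q_{h,i}(X_i)$, $k_j=K_{h,j}(X_j)$, $v_j=V_{h,j}(X_j)$, and the token-wise maps $Q,K,V,\psi$ are arbitrary and may depend on the layer and on the position. **Local encodings.** A $k$-hop local encoding turns a graph $G$ on $\{0,\dots,v-1\}$ into $T_v$ tokens; token $t$ is an arbitrary function, depending on $t$ (and $v$), of the labelled subgraph of $G$ induced on the ball of radius $r_t\le k$ around a vertex $c_t$. A transformer with a $k$-hop local encoding applies a transformer to these tokens and decides by an arbitrary function of the final embedding of one token; the number of tokens and the token-wise maps may depend on $v$. It *solves connectivity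 up to size $N$* if it decides correctly whether $G$ is connected, for every graph $G$ with $1\le|V|\le N$ and $|E|\le N$. **Theorem.** Assume the one-cycle versus two-cycle conjecture. Let $\varepsilon\in(0,1)$ and $C\in\mathbb N$. There are $c>0$ and $N_0$ (depending only on $\varepsilon$ and $C$) such that for all $N\ge N_0$ and all $k\ge1$ with $k\le C N^{1-\varepsilon}$: every transformer with a $k$-hop local encoding that solves connectivity up to size $N$, with precision $p\le C\log N$, at most $CN^C$ heads per layer and at most $CN^C$ tokens for every graph size $v \le N$, has depth $L\ge c\log N$ or width $m\ge c\,N^{1-\varepsilon}/k$. -/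

import Mathlib

open Filter Asymptotics

/-! ## Massively parallel computation and the one-cycle versus two-cycle problem -/

/-- A (non-uniform) MPC protocol whose input is a list of `n` edges on the vertex set `Fin n`.
There is a finite set of machines, a word is an element of `Fin wordSize`, and each machine may
hold at most `memory` words. The local memory of a machine is the collection of messages that it
received in the last round, sorted by sender (so a machine keeps a word by sending it to itself).
Local computation is arbitrary: in round `r`, machine `i` with memory `x` sends the list of words
`send r i x j` to machine `j`. After `rounds` rounds the machine `out` announces the answer. -/
structure MPCProtocol (n : ℕ) where
  Machine : Type
  [fintypeMachine : Fintype Machine]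
  wordSize : ℕ
  le_wordSize : n ≤ wordSize
  memory : ℕ
  rounds : ℕ
  /-- the machine on which an input edge is stored initially -/
  home : Fin n → Machine
  send : ℕ → Machine → (Machine → List (Fin wordSize)) → (Machine → List (Fin wordSize))
  out : Machine
  answer : (Machine → List (Fin wordSize)) → Bool

attribute [instance] MPCProtocol.fintypeMachine

namespace MPCProtocol

variable {n : ℕ} (P : MPCProtocol n)

open Classical in
/-- The initial memory of machine `i`: the two endpoints of each edge stored on it, in the order
of the input (kept as a message of `i` to itself). -/
noncomputable def initial (e : Fin n → Fin n × Fin n) (i j : P.Machine) :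
    List (Fin P.wordSize) :=
  if j = i then
    (List.finRange n).flatMap fun t =>
      if P.home t = i then
        [Fin.castLE P.le_wordSize (e t).1, Fin.castLE P.le_wordSize (e t).2]
      else []
  else []

/-- `P.state e r i j` is what machine `i` holds after `r` rounds on input `e` and has received
from machine `j`. -/
noncomputable def state (e : Fin n → Fin n × Fin n) :
    ℕ → P.Machine → P.Machine → List (Fin P.wordSize)
  | 0 => P.initial e
  | r + 1 => fun i j => P.send r j (state e r j) i

/-- On input `e`, no machine ever holds (equivalently, receives) or sends more than
`P.memory` words. -/
def RespectsMemory (e : Fin n → Fin n × Fin n) : Prop :=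
  (∀ r ≤ P.rounds, ∀ i, ∑ j, (P.state e r i j).length ≤ P.memory) ∧
  (∀ r < P.rounds, ∀ i, ∑ j, (P.send r i (P.state e r i) j).length ≤ P.memory)

/-- The answer of the protocol on input `e`. -/
noncomputable def result (e : Fin n → Fin n × Fin n) : Bool :=
  P.answer (P.state e P.rounds P.out)

end MPCProtocol

/-- The list `e` enumerates the edges of `G`, each exactly once, in some order and with the two
endpoints of each edge in some order. -/
def IsEdgeEncoding {n : ℕ} (G : SimpleGraph (Fin n)) (e : Fin n → Fin n × Fin n) : Prop :=
  (Function.Injective fun t => s((e t).1, (e t).2)) ∧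
  (Set.range fun t => s((e t).1, (e t).2)) = G.edgeSet

/-- `G` is a cycle of length `n`. -/
def IsOneCycle {n : ℕ} (G : SimpleGraph (Fin n)) : Prop :=
  Nonempty (G ≃g SimpleGraph.cycleGraph n)

/-- `G` is the disjoint union of two cycles of length `n / 2` (meant for even `n`). -/
def IsTwoCycles {n : ℕ} (G : SimpleGraph (Fin n)) : Prop :=
  Nonempty (G ≃g (SimpleGraph.cycleGraph (n / 2) ⊕g SimpleGraph.cycleGraph (n / 2)))

/-- The protocol tells one cycle of length `n` from two cycles of length `n / 2`, whatever the
edge encoding of the graph, within its memory bounds. -/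
def MPCProtocol.DistinguishesCycles {n : ℕ} (P : MPCProtocol n) : Prop :=
  ∀ (G : SimpleGraph (Fin n)) (e : Fin n → Fin n × Fin n), IsEdgeEncoding G e →
    (IsOneCycle G → P.RespectsMemory e ∧ P.result e = true) ∧
    (IsTwoCycles G → P.RespectsMemory e ∧ P.result e = false)

/-- The one-cycle versus two-cycle conjecture: an MPC algorithm (a protocol for each `n`) with
words of `O(log n)` bits, local memory `O(n ^ δ)` for some `δ < 1` and polynomially many machines
(hence polynomial global memory) that distinguishes a cycle of length `n` from two cycles of
length `n / 2`, for all even `n ≥ 6`, uses `Ω(log n)` rounds (along the even `n`). -/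
def OneCycleVersusTwoCycleConjecture : Prop :=
  ∀ (δ : ℝ) (γ : ℕ) (P : ∀ n, MPCProtocol n), 0 < δ → δ < 1 →
    (fun n => ((P n).memory : ℝ)) =O[atTop] (fun n : ℕ => (n : ℝ) ^ δ) →
    (fun n => (Fintype.card (P n).Machine : ℝ)) =O[atTop] (fun n : ℕ => (n : ℝ) ^ γ) →
    (fun n => ((P n).wordSize : ℝ)) =O[atTop] (fun n : ℕ => (n : ℝ) ^ γ) →
    (∀ n, 6 ≤ n → Even n → (P n).DistinguishesCycles) →
    (fun n : ℕ => Real.log n) =O[atTop ⊓ 𝓟 {n | Even n}] (fun n => ((P n).rounds : ℝ))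

/-! ## Transformers of bounded precision -/

/-- Fixed-point numbers with `p` fractional bits and absolute value at most `2 ^ p`: the integer
`z` with `|z| ≤ 2 ^ (2 * p)` stands for `z / 2 ^ p`. -/
def Fixed (p : ℕ) : Type := Set.Icc (-(2 ^ (2 * p)) : ℤ) (2 ^ (2 * p))

namespace Fixed

/-- The real number that a fixed-point number stands for. -/
noncomputable def toReal {p : ℕ} (x : Fixed p) : ℝ := ((x.1 : ℤ) : ℝ) / 2 ^ p

theorem neg_bound_le (p : ℕ) : (-(2 ^ (2 * p)) : ℤ) ≤ 2 ^ (2 * p) :=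
  neg_le_self (by positivity)

/-- Rounding to the nearest fixed-point number (numbers out of range are clamped). -/
noncomputable def ofReal (p : ℕ) (x : ℝ) : Fixed p :=
  Set.projIcc (-(2 ^ (2 * p)) : ℤ) (2 ^ (2 * p)) (neg_bound_le p) (round (x * 2 ^ p))

end Fixed

/-- The softmax of a row of scores, in fixed-point arithmetic: the exponentials (of the scores
shifted by their maximum, which does not change the softmax) are rounded. This is the unnormalized
weight of the position `j`. -/
noncomputable def softmaxWeight (p : ℕ) {T : ℕ} (score : Fin T → ℝ) (j : Fin T) : ℝ :=
  (Fixed.ofReal p (Real.exp (score j - ⨆ l, score l))).toReal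

/-- A self-attention head of embedding dimension `m` on `T` tokens. The query, key and value
embeddings are arbitrary token-wise maps that may depend on the position. -/
structure AttentionHead (p m T : ℕ) where
  query : Fin T → (Fin m → Fixed p) → (Fin m → Fixed p)
  key : Fin T → (Fin m → Fixed p) → (Fin m → Fixed p)
  value : Fin T → (Fin m → Fixed p) → (Fin m → Fixed p)

/-- The `(i, j)` entry of the matrix `Q Kᵀ`. -/
noncomputable def AttentionHead.score {p m T : ℕ} (f : AttentionHead p m T)
    (X : Fin T → Fin m → Fixed p) (i j : Fin T) : ℝ :=
  ∑ a, (f.query i (X i) a).toReal * (f.key j (X j) a).toReal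

/-- The output `softmax(Q Kᵀ) V` of the head, rounded. -/
noncomputable def AttentionHead.eval {p m T : ℕ} (f : AttentionHead p m T)
    (X : Fin T → Fin m → Fixed p) (i : Fin T) (a : Fin m) : Fixed p :=
  Fixed.ofReal p
    ((∑ j, softmaxWeight p (f.score X i) j * (f.value j (X j) a).toReal) /
      ∑ j, softmaxWeight p (f.score X i) j)

/-- A transformer of depth `L` and width (embedding dimension) `m` on `T` tokens with `H` heads
per layer. Each layer consists of the attention heads, a residual connection and an arbitrary
token-wise map (MLP), which may depend on the position. -/
structure Transformer (p m L H T : ℕ) where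
  head : Fin L → Fin H → AttentionHead p m T
  mlp : Fin L → Fin T → (Fin m → Fixed p) → (Fin m → Fixed p)

namespace Transformer

variable {p m L H T : ℕ} (F : Transformer p m L H T)

/-- One layer of the transformer. -/
noncomputable def layer (l : Fin L) (X : Fin T → Fin m → Fixed p) : Fin T → Fin m → Fixed p :=
  fun i => F.mlp l i fun a =>
    Fixed.ofReal p ((X i a).toReal + ∑ h, ((F.head l h).eval X i a).toReal)

/-- The embeddings after all layers `0, …, L - 1` have been applied in this order. -/
noncomputable def eval (X : Fin T → Fin m → Fixed p) : Fin T → Fin m → Fixed p :=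
  (List.finRange L).foldl (fun Y l => F.layer l Y) X

end Transformer

/-! ## Local encodings of graphs -/

/-- The set of vertices at distance at most `r` from `c`. -/
def hopBall {V : Type*} (G : SimpleGraph V) (c : V) (r : ℕ) : Set V :=
  {u | G.edist c u ≤ r}

/-- A `k`-hop local encoding of the graphs on `v` vertices as a sequence of `T` tokens in
dimension `m`. The token `t` is an arbitrary function (which may depend on `t`) of the subgraph,
with its vertex labels, that the graph induces on the `radius t`-hop neighbourhood of `center t`,
where `radius t ≤ k`. -/
structure LocalEncoding (v k p m T : ℕ) where
  center : Fin T → Fin v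
  radius : Fin T → ℕ
  radius_le : ∀ t, radius t ≤ k
  encoder : Fin T → (Σ S : Set (Fin v), SimpleGraph S) → (Fin m → Fixed p)

/-- The token sequence of a graph. -/
def LocalEncoding.tokens {v k p m T : ℕ} (E : LocalEncoding v k p m T)
    (G : SimpleGraph (Fin v)) (t : Fin T) : Fin m → Fixed p :=
  E.encoder t ⟨hopBall G (E.center t) (E.radius t), G.induce (hopBall G (E.center t) (E.radius t))⟩

/-- A transformer with a `k`-hop local encoding that makes a yes/no decision on graphs. It accepts
graphs with any number `v` of vertices; the number of tokens and the token-wise maps may depend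
on `v`. The decision is an arbitrary function of the final embedding of one token. -/
structure LocalTransformer (k p m L H : ℕ) where
  numTokens : ℕ → ℕ
  encoding : ∀ v, LocalEncoding v k p m (numTokens v)
  transformer : ∀ v, Transformer p m L H (numTokens v)
  out : ∀ v, 0 < v → Fin (numTokens v)
  readout : ℕ → (Fin m → Fixed p) → Bool

namespace LocalTransformer

variable {k p m L H : ℕ} (A : LocalTransformer k p m L H)

/-- The decision on a (non-empty) graph. -/
noncomputable def decision {v : ℕ} (hv : 0 < v) (G : SimpleGraph (Fin v)) : Bool :=
  A.readout v ((A.transformer v).eval ((A.encoding v).tokens G) (A.out v hv))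

/-- `A` solves connectivity on all graphs with at most `N` vertices and at most `N` edges. -/
def SolvesConnectivity (N : ℕ) : Prop :=
  ∀ (v : ℕ) (hv : 0 < v), v ≤ N → ∀ G : SimpleGraph (Fin v), G.edgeSet.ncard ≤ N →
    (A.decision hv G = true ↔ G.Connected)

end LocalTransformer

/-! A transformer that is both shallow and narrow would give an MPC protocol faster than the
conjecture allows.

The hard graphs are subdivided cycles. For an even `n` of order `N / k`, each of the `n` input edges
is replaced by a path of length `2k + 2`. The result has at most `N` vertices and at most `N` edges.
It is connected for one cycle and disconnected for two. A ball of radius `k` in it is determined by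
the input edges that meet the one or two original vertices next to its center, and there are at most
four of these (`subdivision_hopBall_eq`, `ncard_edgesMeeting_le`). So local encodings carry no
global information.

The simulation uses trees of fan-in `d ≈ n ^ (ε / 2)`. Since `N` is polynomially bounded in `n`, so
are the numbers of tokens and heads, and trees of constant depth suffice. Everything a layer needs
from many positions or heads is a maximum or a sum. In units of a power of two these are exact
integers of `O(log n)` bits, so partial results combine in any grouping and fit in `m + 1` words
(`Comp.aggregate`, `codedBy_partialSums`). A layer is thus a formula of constant depth
(`Comp.layer`). Formulas are evaluated level by level, broadcast trees bound the fan-out, and a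
network with bounded fan-in and fan-out is a protocol (`exists_protocol_of_compStep`). Altogether
there are `O(L + 1)` rounds with local memory `d * (m + 1)`. If `m` is below a small multiple of `N
^ (1 - ε) / k`, then `m ≤ n ^ (1 - ε)` and the memory is `O(n ^ (1 - ε / 2))`.

The conjecture speaks of families of protocols, while here a single transformer gives a protocol for
a single `n`. Applying the conjecture to the family of round-minimal protocols makes it uniform
(`OneCycleVersusTwoCycleConjecture.uniform`). This requires some protocol within the bounds for
every even `n ≥ 6`; slow flooding provides one (`exists_protocol_of_small_memory`). -/

/-! ## Networks of bounded degree and their simulation by MPC protocols -/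

/-- `R` applied `k` times. -/
def IterRel {α : Type*} (R : α → α → Prop) : ℕ → α → α → Prop
  | 0 => Eq
  | k + 1 => fun a c => ∃ b, IterRel R k a b ∧ R b c

theorem IterRel.trans {α : Type*} {R : α → α → Prop} {k : ℕ} {a b : α} (h : IterRel R k a b) :
    ∀ {l : ℕ} {c : α}, IterRel R l b c → IterRel R (k + l) a c
  | 0, _, h' => by cases h'; exact h
  | _ + 1, _, ⟨_, h₁, h₂⟩ => ⟨_, h.trans h₁, h₂⟩

theorem IterRel.single {α : Type*} {R : α → α → Prop} {a b : α} (h : R a b) : IterRel R 1 a b :=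
  ⟨a, rfl, h⟩

theorem IterRel.bind {α β : Type*} {R : α → α → Prop} {S : β → β → Prop} {f : α → β} {l : ℕ}
    (hRS : ∀ a b, R a b → IterRel S l (f a) (f b)) {k : ℕ} {a b : α} (h : IterRel R k a b) :
    IterRel S (k * l) (f a) (f b) := by
  induction k generalizing b with
  | zero => cases h; rw [Nat.zero_mul]; rfl
  | succ k ih =>
    obtain ⟨c, h₁, h₂⟩ := h
    rw [Nat.succ_mul]
    exact (ih h₁).trans (hRS _ _ h₂)

theorem IterRel.exists_seq {α : Type*} {R : α → α → Prop} {k : ℕ} {a b : α}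
    (h : IterRel R k a b) :
    ∃ f : ℕ → α, f 0 = a ∧ f k = b ∧ ∀ r < k, R (f r) (f (r + 1)) := by
  induction k generalizing b with
  | zero => cases h; exact ⟨fun _ => a, rfl, rfl, by simp⟩
  | succ k ih =>
    obtain ⟨c, h₁, h₂⟩ := h
    obtain ⟨f, h0, hk, hf⟩ := ih h₁
    refine ⟨fun r => if r ≤ k then f r else b, by simpa using h0, by simp, fun r hr => ?_⟩
    rcases Nat.lt_succ_iff_lt_or_eq.1 hr with h | rfl
    · simpa [h.le, Nat.succ_le_of_lt h] using hf r h
    · simpa [hk] using h₂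

/-- Every value of `y` is determined by at most `d` values of `x`, and every value of `x` is used
for at most `d` values of `y`. The values depend on an input `e : 𝒳`. -/
def BoundedStep {𝒳 V Ω : Type*} (d : ℕ) (x y : 𝒳 → V → Ω) : Prop :=
  ∃ src : V → Finset V, (∀ v, (src v).card ≤ d) ∧
    (∀ u, ∃ tgt : Finset V, tgt.card ≤ d ∧ ∀ v, u ∈ src v → v ∈ tgt) ∧
    ∀ v e e', (∀ u ∈ src v, x e u = x e' u) → y e v = y e' v

/-- Every value of `y` is determined by at most `d` values of `x`. -/
def FanInStep {𝒳 U Ω : Type*} (d : ℕ) (x y : 𝒳 → U → Ω) : Prop :=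
  ∀ v, ∃ src : Fin d → U, ∀ e e', (∀ a, x e (src a) = x e' (src a)) → y e v = y e' v

/-! ### From bounded networks to protocols -/

open Classical in
/-- The initial memory for a given placement of the edges. -/
noncomputable def initialMemory {n W : ℕ} (hW : n ≤ W) {V : Type} (home : Fin n → V)
    (e : Fin n → Fin n × Fin n) (i j : V) : List (Fin W) :=
  if j = i then
    (List.finRange n).flatMap fun t =>
      if home t = i then [Fin.castLE hW (e t).1, Fin.castLE hW (e t).2] else []
  else []

theorem List.flatMap_ite_eq_of_nodup {α β : Type*} [DecidableEq α] {l : List α} (hl : l.Nodup)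
    {a : α} (ha : a ∈ l) (f : α → List β) :
    (l.flatMap fun b => if b = a then f b else []) = f a := by
  induction l with
  | nil => simp at ha
  | cons b l ih =>
    rw [List.nodup_cons] at hl
    rw [List.flatMap_cons]
    by_cases hb : b = a
    · subst hb
      have : (l.flatMap fun c => if c = b then f c else []) = [] := by
        rw [List.flatMap_eq_nil_iff]
        intro c hc
        rw [if_neg]
        rintro rfl
        exact hl.1 hc
      simp [this]
    · rw [if_neg hb, List.nil_append]
      exact ih hl.2 ((List.mem_cons.1 ha).resolve_left (Ne.symm hb))

theorem initialMemory_home {n W : ℕ} (hW : n ≤ W) {V : Type} {home : Fin n → V}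
    (hhome : Function.Injective home) (e : Fin n → Fin n × Fin n) (t : Fin n) :
    initialMemory hW home e (home t) (home t) =
      [Fin.castLE hW (e t).1, Fin.castLE hW (e t).2] := by
  classical
  rw [initialMemory, if_pos rfl]
  simp_rw [hhome.eq_iff]
  exact List.flatMap_ite_eq_of_nodup (List.nodup_finRange n) (List.mem_finRange t)
    (fun t => [Fin.castLE hW (e t).1, Fin.castLE hW (e t).2])

theorem initialMemory_of_notMem {n W : ℕ} (hW : n ≤ W) {V : Type} {home : Fin n → V}
    (e : Fin n → Fin n × Fin n) {i : V} (hi : i ∉ Set.range home) (j : V) :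
    initialMemory hW home e i j = [] := by
  classical
  rw [initialMemory]
  split_ifs with h
  · rw [List.flatMap_eq_nil_iff]
    intro t _
    rw [if_neg]
    exact fun h => hi ⟨t, h⟩
  · rfl

theorem sum_length_initialMemory_le {n W : ℕ} (hW : n ≤ W) {V : Type} [Fintype V]
    {home : Fin n → V} (hhome : Function.Injective home) (e : Fin n → Fin n × Fin n) (i : V) :
    ∑ j, (initialMemory hW home e i j).length ≤ 2 := by
  classical
  by_cases hi : i ∈ Set.range home
  · obtain ⟨t, rfl⟩ := hi
    rw [Finset.sum_eq_single (home t)]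
    · rw [initialMemory_home hW hhome]; rfl
    · intro j _ hj
      rw [initialMemory, if_neg hj]; rfl
    · simp
  · simp [initialMemory_of_notMem hW e hi]

/-- Each node becomes a machine that sends its value to the nodes that read it. Fan-in bounds what
is received and fan-out what is sent. The hypothesis `hdw` makes room for the two words of an input
edge. -/
theorem exists_protocol_of_boundedStep {n W w d R : ℕ} (hW : n ≤ W) (hdw : 2 ≤ d * w)
    {V Ω : Type} [Fintype V] [Nonempty Ω] (enc : Ω → List (Fin W)) (henc : Function.Injective enc)
    (hlen : ∀ a, (enc a).length ≤ w) {home : Fin n → V} (hhome : Function.Injective home)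
    {𝒳 : Set (Fin n → Fin n × Fin n)} {x y : 𝒳 → V → Ω}
    (hx : ∀ t (e e' : 𝒳), e.1 t = e'.1 t → x e (home t) = x e' (home t))
    (hx' : ∀ v ∉ Set.range home, ∀ e e', x e v = x e' v)
    (hxy : IterRel (BoundedStep d) R x y) (o : V) (b : 𝒳 → Bool)
    (hb : ∀ e e', y e o = y e' o → b e = b e') :
    ∃ P : MPCProtocol n, Fintype.card P.Machine = Fintype.card V ∧ P.wordSize = W ∧
      P.memory = d * w ∧ P.rounds = R ∧
      ∀ e : 𝒳, P.RespectsMemory e ∧ P.result e = b e := by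
  classical
  obtain ⟨f, h0, hR, hf⟩ := hxy.exists_seq
  have hf' : ∀ r, ∃ src : V → Finset V, r < R → (∀ v, (src v).card ≤ d) ∧
      (∀ u, ∃ tgt : Finset V, tgt.card ≤ d ∧ ∀ v, u ∈ src v → v ∈ tgt) ∧
      ∀ v e e', (∀ u ∈ src v, f r e u = f r e' u) → f (r + 1) e v = f (r + 1) e' v := by
    intro r
    by_cases hr : r < R
    · obtain ⟨src, h⟩ := hf r hr
      exact ⟨src, fun _ => h⟩
    · exact ⟨fun _ => ∅, fun h => absurd h hr⟩
  choose src hsrc using hf'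
  let mem : ℕ → 𝒳 → V → V → List (Fin W) := fun r e i =>
    match r with
    | 0 => initialMemory hW home e.1 i
    | r + 1 => fun j => if j ∈ src r i then enc (f r e j) else []
  have hmem : ∀ r ≤ R, ∀ i e e', mem r e i = mem r e' i → f r e i = f r e' i := by
    intro r hr i e e' h
    cases r with
    | zero =>
      rw [h0]
      by_cases hi : i ∈ Set.range home
      · obtain ⟨t, rfl⟩ := hi
        apply hx
        have := congrFun h (home t)
        simp only [mem, initialMemory_home hW hhome, List.cons.injEq, and_true,
          Fin.castLE_inj] at this
        exact Prod.ext this.1 this.2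
      · exact hx' i hi e e'
    | succ r =>
      apply (hsrc r hr).2.2
      intro u hu
      have := congrFun h u
      simp only [mem, if_pos hu] at this
      exact henc this
  -- A machine sees its memory but not the input. It takes any input consistent with that memory; by
  -- `hmem` all of them give the same value.
  let val : ℕ → V → (V → List (Fin W)) → Ω := fun r i m =>
    if h : ∃ e, mem r e i = m then f r h.choose i else Classical.arbitrary Ω
  have hval : ∀ r ≤ R, ∀ i e, val r i (mem r e i) = f r e i := by
    intro r hr i e
    have h : ∃ e', mem r e' i = mem r e i := ⟨e, rfl⟩
    simp only [val, dif_pos h]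
    exact hmem r hr i _ _ h.choose_spec
  let ans : (V → List (Fin W)) → Bool := fun m =>
    if h : ∃ e, mem R e o = m then b h.choose else false
  let P : MPCProtocol n :=
    { Machine := V, wordSize := W, le_wordSize := hW, memory := d * w, rounds := R, home := home
      send := fun r i m j => if i ∈ src r j then enc (val r i m) else []
      out := o, answer := ans }
  have hstate : ∀ e : 𝒳, ∀ r ≤ R, P.state e r = mem r e := by
    intro e r
    induction r with
    | zero => intro _; rfl
    | succ r ih =>
      intro hr
      funext i j
      change (if j ∈ src r i then enc (val r j (P.state e r j)) else []) = _
      rw [ih (by omega), hval r (by omega)]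
  have hsum : ∀ (s : Finset V), s.card ≤ d → ∀ (p : V → Prop) [DecidablePred p],
      (∀ v, p v → v ∈ s) → ∀ g : V → Ω,
      ∑ v, (if p v then enc (g v) else []).length ≤ d * w := by
    intro s hs p _ hp g
    calc ∑ v, (if p v then enc (g v) else []).length
        ≤ ∑ v, if v ∈ s then w else 0 := by
          apply Finset.sum_le_sum
          intro v _
          by_cases h : p v
          · simpa [h, hp v h] using hlen _
          · simp [h]
      _ = s.card * w := by simp
      _ ≤ d * w := Nat.mul_le_mul_right _ hs
  refine ⟨P, rfl, rfl, rfl, rfl, fun e => ⟨⟨fun r hr i => ?_, fun r hr i => ?_⟩, ?_⟩⟩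
  · change ∑ j : V, (P.state e r i j).length ≤ d * w
    rw [hstate e r hr]
    cases r with
    | zero => exact (sum_length_initialMemory_le hW hhome e.1 i).trans hdw
    | succ r => exact hsum (src r i) ((hsrc r hr).1 i) _ (fun v hv => hv) _
  · obtain ⟨tgt, h₁, h₂⟩ := (hsrc r hr).2.1 i
    exact hsum tgt h₁ (fun j => i ∈ src r j) h₂ (fun _ => val r i (P.state e r i))
  · change ans (P.state e R o) = b e
    rw [hstate e R le_rfl]
    have h : ∃ e', mem R e' o = mem R e o := ⟨e, rfl⟩
    simp only [ans, dif_pos h]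
    apply hb
    rw [← hR]
    exact hmem R le_rfl o _ _ h.choose_spec

/-! ### Broadcasting -/

open Classical in
/-- The values `x` on the nodes `pl u`, with a default value on the other nodes. -/
noncomputable def place {𝒳 U V Ω : Type*} [Inhabited Ω] (pl : U → V) (x : 𝒳 → U → Ω) :
    𝒳 → V → Ω :=
  fun e v => if h : ∃ u, pl u = v then x e h.choose else default

theorem place_apply {𝒳 U V Ω : Type*} [Inhabited Ω] {pl : U → V} (hpl : Function.Injective pl)
    (x : 𝒳 → U → Ω) (e : 𝒳) (u : U) : place pl x e (pl u) = x e u := by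
  have h : ∃ u', pl u' = pl u := ⟨u, rfl⟩
  rw [place, dif_pos h, hpl h.choose_spec]

theorem place_of_notMem {𝒳 U V Ω : Type*} [Inhabited Ω] {pl : U → V}
    (x : 𝒳 → U → Ω) (e : 𝒳) {v : V} (hv : v ∉ Set.range pl) : place pl x e v = default :=
  dif_neg hv

/-- The copies of a node are the leaves of a `d`-ary tree of depth `D`, indexed by words. Step `s`
frees coordinate `s`: a copy reads from the copy whose word has that coordinate set to `0`. Fan-in
is one and fan-out at most `d`. -/
theorem iterRel_boundedStep_broadcast {𝒳 U Ω : Type*} [Fintype U] [Inhabited Ω] {d : ℕ}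
    [NeZero d] (D : ℕ) (x : 𝒳 → U → Ω) {s : ℕ} (hs : s ≤ D) :
    IterRel (BoundedStep (𝒳 := 𝒳) (V := U × (Fin D → Fin d)) d) s
      (fun e v => if ∀ i, v.2 i = 0 then x e v.1 else default)
      (fun e v => if ∀ i : Fin D, s ≤ i → v.2 i = 0 then x e v.1 else default) := by
  classical
  induction s with
  | zero => simp [IterRel]
  | succ s ih =>
    refine ⟨_, ih (by omega), ?_⟩
    have hd : 0 < d := Nat.pos_of_ne_zero (NeZero.ne d)
    refine ⟨fun v => {(v.1, Function.update v.2 ⟨s, hs⟩ 0)}, fun v => by simpa using Nat.succ_le_of_lt hd,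
      fun u => ⟨Finset.univ.image fun a : Fin d => (u.1, Function.update u.2 ⟨s, hs⟩ a), ?_, ?_⟩,
      ?_⟩
    · exact Finset.card_image_le.trans (by simp)
    · intro v hv
      rw [Finset.mem_singleton] at hv
      subst hv
      rw [Finset.mem_image]
      exact ⟨v.2 ⟨s, hs⟩, Finset.mem_univ _, by simp⟩
    · intro v e e' h
      specialize h _ (Finset.mem_singleton_self _)
      by_cases hv : ∀ i : Fin D, s + 1 ≤ i → v.2 i = 0
      · have : ∀ i : Fin D, s ≤ i → Function.update v.2 ⟨s, hs⟩ 0 i = 0 := by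
          intro i hi
          by_cases his : i = ⟨s, hs⟩
          · subst his; simp
          · rw [Function.update_of_ne his]
            refine hv i (lt_of_le_of_ne hi fun h => his (Fin.ext h.symm))
        simp only [if_pos this] at h
        simpa only [if_pos hv] using h
      · simp only [if_neg hv]

/-- Once a value is on all `d ^ D` copies, every pair of a consumer and an argument slot gets its
own copy index through `code`, so no copy is read by more than one consumer. The remaining step is
this read, done only by the copies with the zero word. -/
theorem iterRel_boundedStep_of_fanInStep {𝒳 U Ω : Type*} [Fintype U] [Inhabited Ω] {d D : ℕ}
    [NeZero d] (hD : Fintype.card U * d ≤ d ^ D) {x y : 𝒳 → U → Ω} (h : FanInStep d x y) :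
    IterRel (BoundedStep (𝒳 := 𝒳) (V := U × (Fin D → Fin d)) d) (D + 1)
      (fun e v => if ∀ i, v.2 i = 0 then x e v.1 else default)
      (fun e v => if ∀ i, v.2 i = 0 then y e v.1 else default) := by
  classical
  have hd : 0 < d := Nat.pos_of_ne_zero (NeZero.ne d)
  obtain ⟨code⟩ : Nonempty (U × Fin d ↪ (Fin D → Fin d)) :=
    Function.Embedding.nonempty_of_card_le (by simpa using hD)
  choose src hsrc using h
  refine ⟨_, iterRel_boundedStep_broadcast D x le_rfl, ?_⟩
  refine ⟨fun v => if ∀ i, v.2 i = 0 then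
    Finset.univ.image fun a : Fin d => (src v.1 a, code (v.1, a)) else ∅, fun v => ?_, fun u => ?_,
    fun v e e' h => ?_⟩
  · dsimp only
    split_ifs
    · exact Finset.card_image_le.trans (by simp)
    · simp
  · by_cases hu : ∃ v a, u.2 = code (v, a)
    · obtain ⟨v, a, hva⟩ := hu
      refine ⟨{(v, fun _ => 0)}, by simpa using Nat.succ_le_of_lt hd, fun w hw => ?_⟩
      dsimp only at hw
      split_ifs at hw with hw0
      · rw [Finset.mem_image] at hw
        obtain ⟨a', -, ha'⟩ := hw
        rw [Finset.mem_singleton]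
        have := congrArg Prod.snd ha'
        simp only [hva] at this
        have := code.injective this
        simp only [Prod.mk.injEq] at this
        exact Prod.ext this.1 (funext hw0)
      · simp at hw
    · refine ⟨∅, by simp, fun w hw => ?_⟩
      dsimp only at hw
      split_ifs at hw with hw0
      · rw [Finset.mem_image] at hw
        obtain ⟨a', -, ha'⟩ := hw
        exact absurd ⟨w.1, a', by rw [← ha']⟩ hu
      · simp at hw
  · dsimp only at h ⊢
    by_cases hv : ∀ i, v.2 i = 0
    · rw [if_pos hv, if_pos hv]
      apply hsrc
      intro a
      rw [if_pos hv] at h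
      have := h _ (Finset.mem_image_of_mem _ (Finset.mem_univ a))
      -- After `D` broadcasts the condition on the coordinates `i ≥ D` is vacuous, so every copy
      -- carries the value.
      rwa [if_pos (fun i hi => absurd i.2 (by omega)), if_pos (fun i hi => absurd i.2 (by omega))]
        at this
    · rw [if_neg hv, if_neg hv]

/-! ### Formulas -/

/-- Given the values `x e j` (`j : ι`) that depend on an input `e : 𝒳`, the function `φ` of the
input is computed by a formula of depth `D` and fan-in `d` from these values, where all
intermediate results are in `Ω`. -/
def Comp {𝒳 ι : Type*} {Ω : Type} (d : ℕ) (x : 𝒳 → ι → Ω) :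
    ℕ → ∀ {β : Type}, (𝒳 → β) → Prop
  | 0, _, φ => ∃ j, ∀ e e', x e j = x e' j → φ e = φ e'
  | D + 1, _, φ => ∃ ψ : Fin d → 𝒳 → Ω,
      (∀ a, Comp d x D (ψ a)) ∧ ∀ e e', (∀ a, ψ a e = ψ a e') → φ e = φ e'

/-- Each value of `y` is computed by a formula of depth `D` and fan-in `d` from the values of
`x`. -/
def CompStep {𝒳 ι : Type*} {Ω : Type} (d D : ℕ) (x y : 𝒳 → ι → Ω) : Prop :=
  ∀ i, Comp d x D fun e => y e i

theorem Comp.of_factors {𝒳 ι : Type*} {Ω : Type} {d D : ℕ} {x : 𝒳 → ι → Ω} {β γ : Type}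
    {φ : 𝒳 → β} (h : Comp d x D φ) {ψ : 𝒳 → γ} (hψ : ∀ e e', φ e = φ e' → ψ e = ψ e') :
    Comp d x D ψ := by
  cases D with
  | zero => exact h.imp fun j hj e e' he => hψ _ _ (hj e e' he)
  | succ D => exact h.imp fun j hj => ⟨hj.1, fun e e' he => hψ _ _ (hj.2 e e' he)⟩

/-- All formulas are evaluated in parallel from the leaves up. A level at height `j` needs `card κ *
d ^ (D - j)` nodes. Only the current level is stored, so each level can be placed in `U` afresh. -/
theorem Comp.iterRel_place {𝒳 ι U Ω : Type} [Fintype U] [Inhabited Ω] {d : ℕ} [NeZero d]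
    {x : 𝒳 → ι → Ω} {pl₀ : ι → U} (hpl₀ : Function.Injective pl₀) {D : ℕ} :
    ∀ {κ : Type} [Fintype κ] {φ : κ → 𝒳 → Ω}, Fintype.card κ * d ^ D ≤ Fintype.card U →
      (∀ k, Comp d x D (φ k)) → ∀ {pl : κ → U}, Function.Injective pl →
      IterRel (FanInStep d) (D + 1) (place pl₀ x) (place pl fun e k => φ k e) := by
  induction D with
  | zero =>
    intro κ _ φ _ hφ pl hpl
    refine IterRel.single fun v => ?_
    by_cases hv : v ∈ Set.range pl
    · obtain ⟨k, rfl⟩ := hv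
      obtain ⟨j, hj⟩ := hφ k
      refine ⟨fun _ => pl₀ j, fun e e' h => ?_⟩
      simp only [place_apply hpl₀, place_apply hpl] at h ⊢
      exact hj e e' (h 0)
    · exact ⟨fun _ => v, fun e e' _ => by simp only [place_of_notMem _ _ hv]⟩
  | succ D ih =>
    intro κ _ φ hcard hφ pl hpl
    choose ψ hψ using hφ
    have hcard' : Fintype.card (κ × Fin d) * d ^ D ≤ Fintype.card U := by
      rw [Fintype.card_prod, Fintype.card_fin, mul_assoc, ← pow_succ']
      exact hcard
    obtain ⟨pl'⟩ : Nonempty (κ × Fin d ↪ U) :=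
      Function.Embedding.nonempty_of_card_le
        ((Nat.le_mul_of_pos_right _ (pow_pos (Nat.pos_of_ne_zero (NeZero.ne d)) D)).trans hcard')
    refine ⟨_, ih (φ := fun q : κ × Fin d => ψ q.1 q.2) hcard' (fun q => (hψ q.1).1 q.2)
      pl'.injective, fun v => ?_⟩
    by_cases hv : v ∈ Set.range pl
    · obtain ⟨k, rfl⟩ := hv
      refine ⟨fun a => pl' (k, a), fun e e' h => ?_⟩
      simp only [place_apply pl'.injective, place_apply hpl] at h ⊢
      exact (hψ k).2 e e' h
    · exact ⟨fun _ => v, fun e e' _ => by simp only [place_of_notMem _ _ hv]⟩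

/-- Two expansions are composed: a formula step is `D + 1` steps of fan-in `d` on `card ι * d ^ D`
nodes, and each of those is `D' + 1` bounded steps on `d ^ D'` copies of every node. -/
theorem exists_protocol_of_compStep {n W w d D D' R : ℕ} [NeZero W] (hW : n ≤ W) (hw : 1 ≤ w)
    (hd : 2 ≤ d) {ι : Type} [Fintype ι] (hD' : Fintype.card ι * d ^ (D + 1) ≤ d ^ D')
    {home : Fin n → ι} (hhome : Function.Injective home)
    {𝒳 : Set (Fin n → Fin n × Fin n)} {x y : 𝒳 → ι → Fin w → Fin W}
    (hx : ∀ t (e e' : 𝒳), e.1 t = e'.1 t → x e (home t) = x e' (home t))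
    (hx' : ∀ v ∉ Set.range home, ∀ e e', x e v = x e' v)
    (hxy : IterRel (CompStep d D) R x y) (o : ι) (b : 𝒳 → Bool)
    (hb : ∀ e e', y e o = y e' o → b e = b e') :
    ∃ P : MPCProtocol n, Fintype.card P.Machine = Fintype.card ι * d ^ D * d ^ D' ∧
      P.wordSize = W ∧ P.memory = d * w ∧ P.rounds = R * (D + 1) * (D' + 1) ∧
      ∀ e : 𝒳, P.RespectsMemory e ∧ P.result e = b e := by
  classical
  have : NeZero d := ⟨by omega⟩
  let U := Fin (Fintype.card ι * d ^ D)
  obtain ⟨pl⟩ : Nonempty (ι ↪ U) := Function.Embedding.nonempty_of_card_le (by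
    simpa [U] using Nat.le_mul_of_pos_right _ (pow_pos (by omega : 0 < d) D))
  have h₁ : IterRel (FanInStep d) (R * (D + 1)) (place pl x) (place pl y) :=
    hxy.bind fun a b hab => Comp.iterRel_place pl.injective (by simp [U]) hab pl.injective
  have hU : Fintype.card U * d ≤ d ^ D' := by
    simpa [U, mul_assoc, ← pow_succ] using hD'
  have h₂ := h₁.bind (S := BoundedStep d) fun a b hab => iterRel_boundedStep_of_fanInStep hU hab
  let V := U × (Fin D' → Fin d)
  let lift : (𝒳 → ι → Fin w → Fin W) → 𝒳 → V → Fin w → Fin W :=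
    fun z e v => if ∀ i, v.2 i = 0 then place pl z e v.1 else default
  let home' : Fin n → V := fun t => (pl (home t), fun _ => (0 : Fin d))
  have h₃ : ∀ t (e e' : 𝒳), e.1 t = e'.1 t → lift x e (home' t) = lift x e' (home' t) := by
    intro t e e' h
    simpa [lift, home', place_apply pl.injective] using hx t e e' h
  have h₄ : ∀ v ∉ Set.range home', ∀ e e', lift x e v = lift x e' v := by
    intro v hv e e'
    dsimp only [lift]
    split_ifs with h
    · by_cases hpl : v.1 ∈ Set.range pl
      · obtain ⟨i, hi⟩ := hpl
        rw [← hi, place_apply pl.injective, place_apply pl.injective]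
        apply hx'
        rintro ⟨t, rfl⟩
        exact hv ⟨t, Prod.ext hi (funext fun i => (h i).symm)⟩
      · rw [place_of_notMem _ _ hpl, place_of_notMem _ _ hpl]
    · rfl
  have h₅ : ∀ e e', lift y e (pl o, fun _ => 0) = lift y e' (pl o, fun _ => 0) → b e = b e' := by
    intro e e' h
    apply hb
    simpa [lift, place_apply pl.injective] using h
  obtain ⟨P, hP, h⟩ := exists_protocol_of_boundedStep hW (Nat.mul_le_mul hd hw) List.ofFn
    List.ofFn_injective (fun a => by simp) (fun t t' h => hhome (pl.injective (Prod.mk.inj h).1))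
    h₃ h₄ h₂ _ b h₅
  refine ⟨P, ?_, h⟩
  rw [hP]
  simp [U]

/-! ### Operations on formulas -/

/-- The values of `ψ` can be encoded by elements of `Ω`. -/
def CodedBy {𝒳 β : Type*} (Ω : Type*) (ψ : 𝒳 → β) : Prop :=
  ∃ z : 𝒳 → Ω, ∀ e e', z e = z e' → ψ e = ψ e'

/-- An arbitrary code may depend on more than the value of `ψ`. Choosing one representative input
for each value removes this, so that a formula for `ψ` is also one for its code. -/
theorem CodedBy.exists_code {𝒳 β Ω : Type*} {ψ : 𝒳 → β} (h : CodedBy Ω ψ) :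
    ∃ z : 𝒳 → Ω, ∀ e e', z e = z e' ↔ ψ e = ψ e' := by
  obtain ⟨z, hz⟩ := h
  have key : ∀ e, ∃ e', ψ e' = ψ e := fun e => ⟨e, rfl⟩
  refine ⟨fun e => z (key e).choose, fun e e' => ⟨fun h => ?_, fun h => ?_⟩⟩
  · rw [← (key e).choose_spec, ← (key e').choose_spec]
    exact hz _ _ h
  · simp only [h]

theorem CodedBy.of_factors {𝒳 β γ Ω : Type*} {ψ : 𝒳 → β} (h : CodedBy Ω ψ) {φ : 𝒳 → γ}
    (hφ : ∀ e e', ψ e = ψ e' → φ e = φ e') : CodedBy Ω φ :=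
  h.imp fun _ hz e e' he => hφ _ _ (hz e e' he)

theorem CodedBy.const {𝒳 β Ω : Type*} [Nonempty Ω] (b : β) : CodedBy Ω fun _ : 𝒳 => b :=
  ⟨fun _ => Classical.arbitrary Ω, fun _ _ _ => rfl⟩

theorem codedBy_of_embedding {𝒳 β Ω : Type*} (ψ : 𝒳 → β) (f : β ↪ Ω) : CodedBy Ω ψ :=
  ⟨fun e => f (ψ e), fun _ _ h => f.injective h⟩

theorem codedBy_of_card_le {𝒳 β Ω : Type*} [Fintype β] [Fintype Ω] (ψ : 𝒳 → β)
    (h : Fintype.card β ≤ Fintype.card Ω) : CodedBy Ω ψ :=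
  (Function.Embedding.nonempty_of_card_le h).elim (codedBy_of_embedding ψ)

theorem codedBy_of_int {𝒳 β : Type*} {w W B : ℕ} (hW : 2 * B + 1 ≤ W) {ψ : 𝒳 → β}
    (z : 𝒳 → Fin w → ℤ) (hz : ∀ e a, |z e a| ≤ B) (h : ∀ e e', z e = z e' → ψ e = ψ e') :
    CodedBy (Fin w → Fin W) ψ := by
  refine ⟨fun e a => ⟨(z e a + B).toNat, ?_⟩, fun e e' he => h e e' (funext fun a => ?_)⟩
  · have := abs_le.1 (hz e a)
    omega
  · have h₁ := abs_le.1 (hz e a)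
    have h₂ := abs_le.1 (hz e' a)
    have := congrArg Fin.val (congrFun he a)
    simp only at this
    omega

theorem Comp.succ {𝒳 ι Ω β : Type} {d D : ℕ} [NeZero d] {x : 𝒳 → ι → Ω} {φ : 𝒳 → β}
    (h : Comp d x D φ) : Comp d x (D + 1) φ := by
  induction D generalizing β with
  | zero =>
    obtain ⟨j, hj⟩ := h
    exact ⟨fun _ e => x e j, fun _ => ⟨j, fun _ _ h => h⟩, fun e e' he => hj e e' (he 0)⟩
  | succ D ih =>
    obtain ⟨ψ, hψ, h⟩ := h
    exact ⟨ψ, fun a => ih (hψ a), h⟩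

theorem Comp.mono {𝒳 ι Ω β : Type} {d D D' : ℕ} [NeZero d] {x : 𝒳 → ι → Ω} {φ : 𝒳 → β}
    (h : Comp d x D φ) (hD : D ≤ D') : Comp d x D' φ := by
  induction hD with
  | refl => exact h
  | step _ ih => exact ih.succ

theorem Comp.const {𝒳 ι Ω β : Type} [Nonempty ι] {d D : ℕ} [NeZero d] {x : 𝒳 → ι → Ω}
    {φ : 𝒳 → β} (h : ∀ e e', φ e = φ e') : Comp d x D φ :=
  Comp.mono (D := 0) ⟨Classical.arbitrary ι, fun e e' _ => h e e'⟩ (Nat.zero_le D)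

theorem Comp.proj {𝒳 ι Ω β : Type} {d : ℕ} [NeZero d] {x : 𝒳 → ι → Ω} {φ : 𝒳 → β} (D : ℕ) (j : ι)
    (h : ∀ e e', x e j = x e' j → φ e = φ e') : Comp d x D φ :=
  Comp.mono (D := 0) ⟨j, h⟩ (Nat.zero_le D)

theorem Comp.node {𝒳 ι Ω β κ : Type} [Fintype κ] [Nonempty κ] {d D : ℕ}
    (hκ : Fintype.card κ ≤ d) {x : 𝒳 → ι → Ω} {ψ : κ → 𝒳 → Ω} {φ : 𝒳 → β}
    (hψ : ∀ k, Comp d x D (ψ k)) (h : ∀ e e', (∀ k, ψ k e = ψ k e') → φ e = φ e') :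
    Comp d x (D + 1) φ := by
  obtain ⟨f⟩ : Nonempty (κ ↪ Fin d) := Function.Embedding.nonempty_of_card_le (by simpa using hκ)
  refine ⟨fun a => ψ (Function.invFun f a), fun a => hψ _, fun e e' he => h e e' fun k => ?_⟩
  simpa [Function.leftInverse_invFun f.injective k] using he (f k)

theorem Comp.pair {𝒳 ι Ω β₁ β₂ : Type} {d D : ℕ} (hd : 2 ≤ d) {x : 𝒳 → ι → Ω} {φ₁ : 𝒳 → β₁}
    {φ₂ : 𝒳 → β₂} (h₁ : Comp d x D φ₁) (s₁ : CodedBy Ω φ₁) (h₂ : Comp d x D φ₂) (s₂ : CodedBy Ω φ₂) :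
    Comp d x (D + 1) fun e => (φ₁ e, φ₂ e) := by
  obtain ⟨z₁, hz₁⟩ := s₁.exists_code
  obtain ⟨z₂, hz₂⟩ := s₂.exists_code
  refine Comp.node (κ := Fin 2) (ψ := ![z₁, z₂]) (by simpa using hd) ?_ fun e e' h => ?_
  · simp only [Fin.forall_fin_two]
    exact ⟨h₁.of_factors fun e e' h => (hz₁ e e').2 h, h₂.of_factors fun e e' h => (hz₂ e e').2 h⟩
  · simp only [Fin.forall_fin_two] at h
    exact Prod.ext ((hz₁ e e').1 h.1) ((hz₂ e e').1 h.2)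

theorem Comp.triple {𝒳 ι Ω β₁ β₂ β₃ : Type} {d D : ℕ} (hd : 3 ≤ d) {x : 𝒳 → ι → Ω}
    {φ₁ : 𝒳 → β₁} {φ₂ : 𝒳 → β₂} {φ₃ : 𝒳 → β₃} (h₁ : Comp d x D φ₁) (s₁ : CodedBy Ω φ₁)
    (h₂ : Comp d x D φ₂) (s₂ : CodedBy Ω φ₂) (h₃ : Comp d x D φ₃) (s₃ : CodedBy Ω φ₃) :
    Comp d x (D + 1) fun e => (φ₁ e, φ₂ e, φ₃ e) := by
  obtain ⟨z₁, hz₁⟩ := s₁.exists_code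
  obtain ⟨z₂, hz₂⟩ := s₂.exists_code
  obtain ⟨z₃, hz₃⟩ := s₃.exists_code
  refine Comp.node (κ := Fin 3) (ψ := ![z₁, z₂, z₃]) (by simpa using hd) ?_ fun e e' h => ?_
  · simp only [Fin.forall_fin_succ, Fin.forall_fin_zero]
    exact ⟨h₁.of_factors fun e e' h => (hz₁ e e').2 h, h₂.of_factors fun e e' h => (hz₂ e e').2 h,
      h₃.of_factors fun e e' h => (hz₃ e e').2 h, trivial⟩
  · exact Prod.ext ((hz₁ e e').1 (h 0)) (Prod.ext ((hz₂ e e').1 (h 1)) ((hz₃ e e').1 (h 2)))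

/-- The elements are enumerated and cut into consecutive blocks of length `K`: the quotient of the
position by `K` is the color, and the remainder is injective on each color. -/
theorem Finset.exists_balanced_partition {κ : Type*} {d K : ℕ} (s : Finset κ) [NeZero d]
    (hs : s.card ≤ d * K) :
    ∃ c : κ → Fin d, ∀ a, (s.filter fun k => c k = a).card ≤ K := by
  classical
  rcases Nat.eq_zero_or_pos K with rfl | hK
  · have : s = ∅ := by simpa using hs
    exact ⟨fun _ => 0, by simp [this]⟩
  have hlt : ∀ i : Fin s.card, i.1 / K < d := fun i =>
    Nat.div_lt_of_lt_mul (i.2.trans_le (by rwa [mul_comm]))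
  let c : κ → Fin d := fun k => if h : k ∈ s then ⟨_, hlt (s.equivFin ⟨k, h⟩)⟩ else 0
  let r : κ → ℕ := fun k => if h : k ∈ s then (s.equivFin ⟨k, h⟩).1 % K else 0
  refine ⟨c, fun a => ?_⟩
  rw [← Finset.card_range K]
  refine Finset.card_le_card_of_injOn r ?_ ?_
  · intro k hk
    have hk : k ∈ s := (Finset.mem_filter.1 hk).1
    simp only [r, dif_pos hk, Finset.coe_range, Set.mem_Iio]
    exact Nat.mod_lt _ hK
  · intro k hk l hl hkl
    obtain ⟨hk, hka⟩ := Finset.mem_filter.1 hk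
    obtain ⟨hl, hla⟩ := Finset.mem_filter.1 hl
    have hc := congrArg Fin.val (hka.trans hla.symm)
    simp only [r, c, dif_pos hk, dif_pos hl] at hkl hc
    have : (s.equivFin ⟨k, hk⟩).1 = (s.equivFin ⟨l, hl⟩).1 := by
      rw [← Nat.div_add_mod (s.equivFin ⟨k, hk⟩).1 K, ← Nat.div_add_mod (s.equivFin ⟨l, hl⟩).1 K,
        hkl, hc]
    simpa using s.equivFin.injective (Fin.ext this)

/-- The abstract form of a reduction tree: when the parts of a disjoint union determine the whole
and every partial result can be coded in one node, `d ^ D'` items need only `D'` further levels. It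
serves maxima, sums, unions and quantifiers alike. -/
theorem Comp.aggregate {𝒳 ι Ω β κ : Type} {d D : ℕ} [NeZero d] {x : 𝒳 → ι → Ω}
    {Φ : Finset κ → 𝒳 → β} (hsmall : ∀ s, CodedBy Ω (Φ s)) (hempty : ∀ e e', Φ ∅ e = Φ ∅ e')
    (hsingle : ∀ s, s.card ≤ 1 → Comp d x D (Φ s))
    (hunion : ∀ s t e e', Disjoint s t → Φ s e = Φ s e' → Φ t e = Φ t e' →
      ∀ u, (∀ k, k ∈ u ↔ k ∈ s ∨ k ∈ t) → Φ u e = Φ u e')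
    {D' : ℕ} {s : Finset κ} (hs : s.card ≤ d ^ D') : Comp d x (D + D') (Φ s) := by
  classical
  induction D' generalizing s with
  | zero => exact hsingle s (by simpa using hs)
  | succ D' ih =>
    obtain ⟨c, hc⟩ := s.exists_balanced_partition (by rwa [pow_succ'] at hs)
    choose z hz using fun t => (hsmall t).exists_code
    refine ⟨fun a => z (s.filter fun k => c k = a), fun a =>
      (ih (hc a)).of_factors fun e e' h => (hz _ e e').2 h, fun e e' h => ?_⟩
    -- The node receives the results of the `d` color classes; they are merged one class at a time.
    have key : ∀ A : Finset (Fin d), Φ (s.filter fun k => c k ∈ A) e =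
        Φ (s.filter fun k => c k ∈ A) e' := by
      intro A
      induction A using Finset.induction_on with
      | empty => simpa using hempty e e'
      | insert a A ha ihA =>
        refine hunion _ _ e e' ?_ ((hz _ e e').1 (h a)) ihA _ fun k => ?_
        · rw [Finset.disjoint_left]
          intro k hk hk'
          rw [Finset.mem_filter] at hk hk'
          exact ha (hk.2 ▸ hk'.2)
        · simp only [Finset.mem_filter, Finset.mem_insert]
          tauto
    simpa using key Finset.univ

/-! ## A transformer layer as a formula -/

theorem Fixed.abs_le {p : ℕ} (x : Fixed p) : |(x.1 : ℤ)| ≤ 4 ^ p := by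
  rw [show (4 : ℤ) ^ p = 2 ^ (2 * p) by rw [pow_mul]; norm_num]
  exact _root_.abs_le.2 x.2

theorem four_pow_mul_four_pow (p : ℕ) : (4 : ℤ) ^ p * 4 ^ p = 16 ^ p := by
  rw [← mul_pow]; norm_num

/-- The score `q i ⬝ k j` in units of `2 ^ (-2 p)`. -/
def AttentionHead.intScore {p m T : ℕ} (f : AttentionHead p m T)
    (X : Fin T → Fin m → Fixed p) (i j : Fin T) : ℤ :=
  ∑ a, (f.query i (X i) a).1 * (f.key j (X j) a).1

theorem AttentionHead.score_eq {p m T : ℕ} (f : AttentionHead p m T)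
    (X : Fin T → Fin m → Fixed p) (i j : Fin T) :
    f.score X i j = f.intScore X i j / (2 ^ p * 2 ^ p) := by
  simp only [AttentionHead.score, AttentionHead.intScore, Fixed.toReal, Int.cast_sum, Int.cast_mul,
    Finset.sum_div, div_mul_div_comm]

theorem Fixed.abs_mul_le {p : ℕ} (x y : Fixed p) : |(x.1 : ℤ) * y.1| ≤ 16 ^ p := by
  rw [abs_mul, ← four_pow_mul_four_pow]
  exact mul_le_mul x.abs_le y.abs_le (abs_nonneg _) (by positivity)

theorem Finset.abs_sum_le_card_mul {ι : Type*} (s : Finset ι) (f : ι → ℤ) {B : ℤ}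
    (h : ∀ i ∈ s, |f i| ≤ B) : |∑ i ∈ s, f i| ≤ s.card * B := by
  refine (Finset.abs_sum_le_sum_abs _ _).trans ((Finset.sum_le_card_nsmul _ _ _ h).trans ?_)
  simp

theorem AttentionHead.abs_intScore_le {p m T : ℕ} (f : AttentionHead p m T)
    (X : Fin T → Fin m → Fixed p) (i j : Fin T) : |f.intScore X i j| ≤ m * 16 ^ p := by
  simpa [AttentionHead.intScore] using Finset.abs_sum_le_card_mul Finset.univ _ (B := 16 ^ p)
    fun a _ => Fixed.abs_mul_le (f.query i (X i) a) (f.key j (X j) a)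

/-- The maximum is taken over integers with a bottom element, so that it is defined on the empty set
and can be aggregated. On all positions it determines the real supremum in the softmax. -/
theorem iSup_score_eq {p m T : ℕ} (f : AttentionHead p m T)
    (X : Fin T → Fin m → Fixed p) (i : Fin T) {M : ℤ}
    (hM : Finset.univ.sup (fun j => (f.intScore X i j : WithBot ℤ)) = M) :
    ⨆ l, f.score X i l = M / (2 ^ p * 2 ^ p) := by
  have : Nonempty (Fin T) := ⟨i⟩
  apply le_antisymm
  · refine ciSup_le fun l => ?_
    rw [f.score_eq]
    have : (f.intScore X i l : WithBot ℤ) ≤ M :=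
      hM ▸ Finset.le_sup (f := fun j => (f.intScore X i j : WithBot ℤ)) (Finset.mem_univ l)
    have : f.intScore X i l ≤ M := WithBot.coe_le_coe.1 this
    gcongr
  · obtain ⟨j, -, hj⟩ := Finset.exists_mem_eq_sup Finset.univ Finset.univ_nonempty
      (fun j => (f.intScore X i j : WithBot ℤ))
    rw [hM] at hj
    rw [WithBot.coe_injective hj, ← f.score_eq]
    exact le_ciSup (Set.finite_range _).bddAbove j

section Layer

variable {𝒳 ι : Type} {p m T d W : ℕ} [NeZero d] {x : 𝒳 → ι → Fin (m + 1) → Fin W}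
  {Y : 𝒳 → Fin T → Fin m → Fixed p} {tok : Fin T → ι}

theorem codedBy_token (hx : ∀ i e e', x e (tok i) = x e' (tok i) → Y e i = Y e' i) (i : Fin T) :
    CodedBy (Fin (m + 1) → Fin W) fun e => Y e i :=
  ⟨fun e => x e (tok i), hx i⟩

theorem Comp.token (hx : ∀ i e e', x e (tok i) = x e' (tok i) → Y e i = Y e' i) (D : ℕ)
    (i : Fin T) : Comp d x D fun e => Y e i :=
  Comp.proj D (tok i) (hx i)

theorem codedBy_sup_intScore (hW : 2 * (m * 16 ^ p) + 1 ≤ W) (f : AttentionHead p m T) (i : Fin T)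
    (s : Finset (Fin T)) :
    CodedBy (Fin (m + 1) → Fin W)
      fun e => s.sup fun j => (f.intScore (Y e) i j : WithBot ℤ) := by
  have : NeZero W := ⟨by omega⟩
  rcases s.eq_empty_or_nonempty with rfl | hs
  · exact CodedBy.const ⊥
  choose j _ hj using fun e => Finset.exists_mem_eq_sup s hs
    fun j => (f.intScore (Y e) i j : WithBot ℤ)
  refine codedBy_of_int hW (fun e _ => f.intScore (Y e) i (j e))
    (fun e _ => by exact_mod_cast f.abs_intScore_le _ _ _) fun e e' h => ?_
  rw [hj, hj, show f.intScore (Y e) i (j e) = f.intScore (Y e') i (j e') from congrFun h 0]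

theorem Comp.sup_intScore (hd : 2 ≤ d) (hW : 2 * (m * 16 ^ p) + 1 ≤ W)
    (hx : ∀ i e e', x e (tok i) = x e' (tok i) → Y e i = Y e' i)
    {a : ℕ} (hT : T ≤ d ^ a) (f : AttentionHead p m T) (i : Fin T) :
    Comp d x (1 + a) fun e => Finset.univ.sup fun j => (f.intScore (Y e) i j : WithBot ℤ) := by
  have : Nonempty ι := ⟨tok i⟩
  refine Comp.aggregate (Φ := fun s e => s.sup fun j => (f.intScore (Y e) i j : WithBot ℤ))
    (codedBy_sup_intScore hW f i) (fun _ _ => rfl) (fun s hs => ?_) (fun s t e e' _ h₁ h₂ u hu => ?_)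
    (by simpa using hT)
  · rcases Nat.le_one_iff_eq_zero_or_eq_one.1 hs with hs | hs
    · rw [Finset.card_eq_zero] at hs
      subst hs
      exact Comp.const fun _ _ => rfl
    · obtain ⟨j, rfl⟩ := Finset.card_eq_one.1 hs
      refine (Comp.pair hd (Comp.token hx 0 i) (codedBy_token hx i) (Comp.token hx 0 j)
        (codedBy_token hx j)).of_factors fun e e' h => ?_
      simp only [Finset.sup_singleton, AttentionHead.intScore, (Prod.mk.inj h).1,
        (Prod.mk.inj h).2]
  · have : u = s ∪ t := Finset.ext fun k => by rw [hu, Finset.mem_union]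
    simp only [this, Finset.sup_union, h₁, h₂]

/-- The contribution of a set of positions to the numerators and the denominator of a head. -/
noncomputable def AttentionHead.partialSums (f : AttentionHead p m T)
    (X : Fin T → Fin m → Fixed p) (i : Fin T) (s : Finset (Fin T)) : ℝ × (Fin m → ℝ) :=
  (∑ j ∈ s, softmaxWeight p (f.score X i) j,
    fun a => ∑ j ∈ s, softmaxWeight p (f.score X i) j * (f.value j (X j) a).toReal)

/-- One denominator and `m` numerators, all integers in units of `2 ^ (-p)` or `2 ^ (-2 p)`: this is
why a node holds `m + 1` words. -/
theorem codedBy_partialSums (hW : 2 * (T * 16 ^ p) + 1 ≤ W) (f : AttentionHead p m T) (i : Fin T)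
    (s : Finset (Fin T)) :
    CodedBy (Fin (m + 1) → Fin W) fun e => f.partialSums (Y e) i s := by
  let w : 𝒳 → Fin T → Fixed p := fun e j =>
    Fixed.ofReal p (Real.exp (f.score (Y e) i j - ⨆ l, f.score (Y e) i l))
  have hs : (s.card : ℤ) ≤ T := by exact_mod_cast s.card_le_univ.trans_eq (Fintype.card_fin T)
  refine codedBy_of_int hW (fun e => Fin.cons (∑ j ∈ s, (w e j).1)
    fun a => ∑ j ∈ s, (w e j).1 * (f.value j (Y e j) a).1) (fun e a => ?_) fun e e' h => ?_
  · push_cast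
    refine Fin.cases ?_ (fun a => ?_) a
    · rw [Fin.cons_zero]
      refine (Finset.abs_sum_le_card_mul s _ fun j _ => (w e j).abs_le).trans ?_
      gcongr
      norm_num
    · rw [Fin.cons_succ]
      refine (Finset.abs_sum_le_card_mul s _ fun j _ => Fixed.abs_mul_le _ _).trans ?_
      gcongr
  · have h0 : ∑ j ∈ s, ((w e j).1 : ℤ) = ∑ j ∈ s, ((w e' j).1 : ℤ) := congrFun h 0
    have h1 : ∀ a, ∑ j ∈ s, (w e j).1 * (f.value j (Y e j) a).1 =
        ∑ j ∈ s, (w e' j).1 * (f.value j (Y e' j) a).1 := fun a => congrFun h a.succ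
    refine Prod.ext ?_ (funext fun a => ?_)
    · change ∑ j ∈ s, ((w e j).1 : ℝ) / 2 ^ p = ∑ j ∈ s, ((w e' j).1 : ℝ) / 2 ^ p
      rw [← Finset.sum_div, ← Finset.sum_div]
      exact_mod_cast congrArg (fun z : ℤ => (z : ℝ) / 2 ^ p) h0
    · change ∑ j ∈ s, ((w e j).1 : ℝ) / 2 ^ p * ((f.value j (Y e j) a).1 / 2 ^ p) =
        ∑ j ∈ s, ((w e' j).1 : ℝ) / 2 ^ p * ((f.value j (Y e' j) a).1 / 2 ^ p)
      simp only [div_mul_div_comm, ← Finset.sum_div]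
      exact_mod_cast congrArg (fun z : ℤ => (z : ℝ) / (2 ^ p * 2 ^ p)) (h1 a)

/-- The weight of a position needs the two tokens and the maximal score. The formula for the
maximum, of depth `1 + a`, therefore sits below every leaf; one level joins the three ingredients,
and `a` more levels add up the positions. -/
theorem Comp.partialSums (hd : 3 ≤ d) (hW : 2 * ((T + m) * 16 ^ p) + 1 ≤ W)
    (hx : ∀ i e e', x e (tok i) = x e' (tok i) → Y e i = Y e' i)
    {a : ℕ} (hT : T ≤ d ^ a) (f : AttentionHead p m T) (i : Fin T) :
    Comp d x (1 + a + 1 + a) fun e => f.partialSums (Y e) i Finset.univ := by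
  have : Nonempty ι := ⟨tok i⟩
  have hWm : 2 * (m * 16 ^ p) + 1 ≤ W := by nlinarith [Nat.zero_le (T * 16 ^ p)]
  have hWT : 2 * (T * 16 ^ p) + 1 ≤ W := by nlinarith [Nat.zero_le (m * 16 ^ p)]
  refine Comp.aggregate (Φ := fun s e => f.partialSums (Y e) i s)
    (codedBy_partialSums hWT f i) (fun _ _ => by simp [AttentionHead.partialSums])
    (fun s hs => ?_) (fun s t e e' hst h₁ h₂ u hu => ?_) (by simpa using hT)
  · rcases Nat.le_one_iff_eq_zero_or_eq_one.1 hs with hs | hs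
    · rw [Finset.card_eq_zero] at hs
      subst hs
      exact Comp.const fun _ _ => by simp [AttentionHead.partialSums]
    · obtain ⟨j, rfl⟩ := Finset.card_eq_one.1 hs
      refine (Comp.triple hd (Comp.token hx _ i) (codedBy_token hx i) (Comp.token hx _ j)
        (codedBy_token hx j) (Comp.sup_intScore (by omega) hWm hx hT f i)
        (codedBy_sup_intScore hWm f i _)).of_factors fun e e' h => ?_
      obtain ⟨hi, hj, hM⟩ : Y e i = Y e' i ∧ Y e j = Y e' j ∧ _ :=
        ⟨(Prod.mk.inj h).1, (Prod.mk.inj (Prod.mk.inj h).2).1, (Prod.mk.inj (Prod.mk.inj h).2).2⟩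
      have hscore : f.score (Y e) i j = f.score (Y e') i j := by
        simp only [AttentionHead.score, hi, hj]
      have hsup : ⨆ l, f.score (Y e) i l = ⨆ l, f.score (Y e') i l := by
        obtain ⟨l, -, hl⟩ := Finset.exists_mem_eq_sup Finset.univ ⟨i, Finset.mem_univ i⟩
          fun j => (f.intScore (Y e) i j : WithBot ℤ)
        rw [iSup_score_eq f (Y e) i hl, iSup_score_eq f (Y e') i (hM ▸ hl)]
      simp only [AttentionHead.partialSums, Finset.sum_singleton, softmaxWeight, hscore, hsup, hj]
  · classical
    have : u = s ∪ t := Finset.ext fun k => by rw [hu, Finset.mem_union]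
    obtain ⟨h₁, h₁'⟩ := Prod.mk.inj h₁
    obtain ⟨h₂, h₂'⟩ := Prod.mk.inj h₂
    refine Prod.ext ?_ (funext fun b => ?_)
    · simp only [this, AttentionHead.partialSums, Finset.sum_union hst, h₁, h₂]
    · have h₁' := congrFun h₁' b
      have h₂' := congrFun h₂' b
      simp only [this, AttentionHead.partialSums, Finset.sum_union hst, h₁', h₂']

theorem Comp.headEval (hd : 3 ≤ d) (hW : 2 * ((T + m) * 16 ^ p) + 1 ≤ W)
    (hx : ∀ i e e', x e (tok i) = x e' (tok i) → Y e i = Y e' i)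
    {a : ℕ} (hT : T ≤ d ^ a) (f : AttentionHead p m T) (i : Fin T) :
    Comp d x (1 + a + 1 + a) fun e => f.eval (Y e) i := by
  refine (Comp.partialSums hd hW hx hT f i).of_factors fun e e' h => funext fun b => ?_
  obtain ⟨h₁, h₂⟩ := Prod.mk.inj h
  have h₂ := congrFun h₂ b
  rw [AttentionHead.eval, AttentionHead.eval, h₁, h₂]

theorem codedBy_sum_toReal {H : ℕ} (hW : 2 * (H * 16 ^ p) + 1 ≤ W)
    (g : 𝒳 → Fin H → Fin m → Fixed p) (s : Finset (Fin H)) :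
    CodedBy (Fin (m + 1) → Fin W) fun e a => ∑ h ∈ s, (g e h a).toReal := by
  have hs : (s.card : ℤ) ≤ H := by exact_mod_cast s.card_le_univ.trans_eq (Fintype.card_fin H)
  refine codedBy_of_int hW (fun e => Fin.cons 0 fun a => ∑ h ∈ s, (g e h a).1) (fun e a => ?_)
    fun e e' h => funext fun a => ?_
  · push_cast
    refine Fin.cases ?_ (fun a => ?_) a
    · rw [Fin.cons_zero, abs_zero]
      positivity
    · rw [Fin.cons_succ]
      refine (Finset.abs_sum_le_card_mul s _ fun h _ => (g e h a).abs_le).trans ?_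
      gcongr
      norm_num
  · have h1 : ∑ h ∈ s, ((g e h a).1 : ℤ) = ∑ h ∈ s, ((g e' h a).1 : ℤ) := congrFun h a.succ
    simp only [Fixed.toReal, ← Finset.sum_div]
    exact_mod_cast congrArg (fun z : ℤ => (z : ℝ) / 2 ^ p) h1

/-- A transformer layer is computed by formulas of constant depth. -/
theorem Comp.layer {L H : ℕ} (hd : 3 ≤ d) (hW : 2 * ((T + m + H) * 16 ^ p) + 1 ≤ W)
    (hx : ∀ i e e', x e (tok i) = x e' (tok i) → Y e i = Y e' i)
    {a b : ℕ} (hT : T ≤ d ^ a) (hH : H ≤ d ^ b) (F : Transformer p m L H T) (l : Fin L)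
    (i : Fin T) : Comp d x (1 + a + 1 + a + b + 1) fun e => F.layer l (Y e) i := by
  have : Nonempty ι := ⟨tok i⟩
  have hWT : 2 * ((T + m) * 16 ^ p) + 1 ≤ W := by nlinarith [Nat.zero_le (H * 16 ^ p)]
  have hWH : 2 * (H * 16 ^ p) + 1 ≤ W := by nlinarith [Nat.zero_le ((T + m) * 16 ^ p)]
  have hsum : Comp d x (1 + a + 1 + a + b)
      fun e b => ∑ h, ((F.head l h).eval (Y e) i b).toReal := by
    refine Comp.aggregate (Φ := fun s e b => ∑ h ∈ s, ((F.head l h).eval (Y e) i b).toReal)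
      (codedBy_sum_toReal hWH fun e h => (F.head l h).eval (Y e) i) (fun _ _ => by simp)
      (fun s hs => ?_) (fun s t e e' hst h₁ h₂ u hu => ?_) (by simpa using hH)
    · rcases Nat.le_one_iff_eq_zero_or_eq_one.1 hs with hs | hs
      · rw [Finset.card_eq_zero] at hs
        subst hs
        exact Comp.const fun _ _ => by simp
      · obtain ⟨h, rfl⟩ := Finset.card_eq_one.1 hs
        refine (Comp.headEval hd hWT hx hT (F.head l h) i).of_factors fun e e' he => ?_
        simp only [Finset.sum_singleton, he]
    · classical
      have : u = s ∪ t := Finset.ext fun k => by rw [hu, Finset.mem_union]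
      refine funext fun b => ?_
      have h₁ := congrFun h₁ b
      have h₂ := congrFun h₂ b
      simp only [this, Finset.sum_union hst, h₁, h₂]
  -- The last level joins the sum over the heads with the token itself, for the residual connection
  -- and the MLP.
  refine (Comp.pair (by omega) (Comp.token hx _ i) (codedBy_token hx i) hsum
    (codedBy_sum_toReal hWH (fun e h => (F.head l h).eval (Y e) i) _)).of_factors fun e e' h => ?_
  obtain ⟨h₁, h₂⟩ := Prod.mk.inj h
  simp only [Transformer.layer]
  congr 1
  funext b
  have h₂ := congrFun h₂ b
  rw [h₁, h₂]

end Layer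

/-- The state of a network in which the nodes `Sum.inr t` hold (an encoding of) the values
`Y e t`. -/
def tokenState {𝒳 β Ω : Type*} [Inhabited Ω] (n : ℕ) {T : ℕ} (enc : β → Ω) (Y : 𝒳 → Fin T → β) :
    𝒳 → Fin n ⊕ Fin T → Ω :=
  fun e => Sum.elim (fun _ => default) fun t => enc (Y e t)

theorem compStep_tokenState {𝒳 β ι Ω : Type} [Inhabited Ω] [Nonempty ι] {n T d D : ℕ} [NeZero d]
    {enc : β → Ω} {Y : 𝒳 → Fin T → β} {x : 𝒳 → ι → Ω} (h : ∀ i, Comp d x D fun e => Y e i)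
    (i : Fin n ⊕ Fin T) : Comp d x D fun e => tokenState n enc Y e i := by
  rcases i with i | i
  · exact Comp.const fun _ _ => rfl
  · exact (h i).of_factors fun e e' h => by simp only [tokenState, Sum.elim_inr, h]

theorem exists_injective_code {p m W : ℕ} (hW : 2 * 4 ^ p + 1 ≤ W) :
    ∃ enc : (Fin m → Fixed p) → Fin (m + 1) → Fin W, Function.Injective enc := by
  obtain ⟨z, hz⟩ : CodedBy (Fin (m + 1) → Fin W) (fun X : Fin m → Fixed p => X) :=
    codedBy_of_int (B := 4 ^ p) hW (fun X => Fin.cons 0 fun a => (X a).1)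
      (fun X a => by
        push_cast
        refine Fin.cases ?_ (fun a => ?_) a
        · rw [Fin.cons_zero, abs_zero]; positivity
        · rw [Fin.cons_succ]; exact (X a).abs_le)
      fun X X' h => funext fun a => Subtype.ext (congrFun h a.succ)
  exact ⟨z, fun X X' h => hz X X' h⟩

theorem iterRel_compStep_eval {𝒳 : Type} {n p m L H T d W a b : ℕ} [NeZero d] [NeZero W]
    (hd : 3 ≤ d) (hW : 2 * ((T + m + H) * 16 ^ p) + 1 ≤ W) (hT : T ≤ d ^ a) (hH : H ≤ d ^ b)
    {enc : (Fin m → Fixed p) → Fin (m + 1) → Fin W} (henc : Function.Injective enc)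
    (F : Transformer p m L H T) (Y : 𝒳 → Fin T → Fin m → Fixed p) :
    IterRel (CompStep d (1 + a + 1 + a + b + 1)) L (tokenState n enc Y)
      (tokenState n enc fun e => F.eval (Y e)) := by
  have key : ∀ (l : List (Fin L)) (Y : 𝒳 → Fin T → Fin m → Fixed p),
      IterRel (CompStep d (1 + a + 1 + a + b + 1)) l.length (tokenState n enc Y)
        (tokenState n enc fun e => l.foldl (fun Y l => F.layer l Y) (Y e)) := by
    intro l
    induction l with
    | nil => exact fun _ => rfl
    | cons l₀ l ih =>
      intro Y
      rw [List.length_cons, add_comm l.length]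
      refine (IterRel.single fun i => ?_).trans (ih fun e => F.layer l₀ (Y e))
      have : Nonempty (Fin n ⊕ Fin T) := ⟨i⟩
      refine compStep_tokenState (fun t => Comp.layer (tok := Sum.inr) hd hW ?_ hT hH F l₀ t) i
      exact fun t e e' h => henc h
  simpa [Transformer.eval] using key (List.finRange L) Y

/-! ## Balls in subgraphs -/

theorem hopBall_induce_congr {V : Type*} {G H : SimpleGraph V} {S S' : Set V} (hS : S = S')
    (h : ∀ x ∈ S, ∀ y ∈ S, G.Adj x y ↔ H.Adj x y) :
    (⟨S, G.induce S⟩ : Σ S : Set V, SimpleGraph S) = ⟨S', H.induce S'⟩ := by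
  subst hS
  congr 1
  ext x y
  exact h x x.2 y y.2

/-- A ball only depends on the edges that have an end in it. -/
theorem hopBall_eq_of_le {V : Type*} {G H : SimpleGraph V} (hHG : H ≤ G) (c : V) (r : ℕ)
    (h : ∀ x y, G.edist c x ≤ r → G.Adj x y → H.Adj x y) :
    (⟨hopBall G c r, G.induce (hopBall G c r)⟩ : Σ S : Set V, SimpleGraph S) =
      ⟨hopBall H c r, H.induce (hopBall H c r)⟩ := by
  classical
  refine hopBall_induce_congr (Set.Subset.antisymm (fun u hu => ?_) fun u hu => ?_)
    fun x hx y _ => ⟨h x y hx, fun hxy => hHG hxy⟩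
  · have hu : G.edist c u ≤ r := hu
    have hne : G.edist c u ≠ ⊤ := ne_top_of_le_ne_top (ENat.natCast_ne_top r) hu
    obtain ⟨p, hp⟩ := SimpleGraph.exists_walk_of_edist_ne_top hne
    rw [← hp, Nat.cast_le] at hu
    -- A shortest walk from the center stays in the ball, so all its edges have an end there and
    -- survive in `H`.
    have hsupp : ∀ a ∈ p.support, G.edist c a ≤ r := fun a ha =>
      (SimpleGraph.edist_le (p.takeUntil a ha)).trans
        (Nat.cast_le.2 ((p.length_takeUntil_le_length ha).trans hu))
    have hp' : ∀ e ∈ p.edges, e ∈ H.edgeSet := by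
      intro e he
      induction e with | _ a b =>
      exact h a b (hsupp a (p.fst_mem_support_of_mem_edges he)) (p.adj_of_mem_edges he)
    have := SimpleGraph.edist_le (p.transfer H hp')
    rw [SimpleGraph.Walk.length_transfer] at this
    exact this.trans (Nat.cast_le.2 hu)
  · exact (SimpleGraph.edist_anti hHG).trans hu

theorem le_add_of_edist_le {V : Type*} {G : SimpleGraph V} {f : V → ℕ}
    (hf : ∀ x y, G.Adj x y → f y ≤ f x + 1) {c x : V} {r : ℕ} (h : G.edist c x ≤ r) :
    f x ≤ f c + r := by
  have hne : G.edist c x ≠ ⊤ := ne_top_of_le_ne_top (ENat.natCast_ne_top r) h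
  obtain ⟨p, hp⟩ := SimpleGraph.exists_walk_of_edist_ne_top hne
  rw [← hp, Nat.cast_le] at h
  have key : ∀ {a b : V} (p : G.Walk a b), f b ≤ f a + p.length := by
    intro a b p
    induction p with
    | nil => simp
    | cons hab p ih =>
      rw [SimpleGraph.Walk.length_cons]
      have := hf _ _ hab
      omega
  have := key p
  omega

/-! ## Subdivisions -/

section Subdivision

variable {n ℓ : ℕ} [NeZero ℓ]

/-- The `s`-th vertex of the path of length `ℓ` that replaces an edge `q = (t, u, v)` with index
`t` from `u` to `v`. The vertices `(u, 0)` are the original ones. -/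
def pathVertex (q : Fin n × Fin n × Fin n) (s : ℕ) : Fin n × Fin ℓ :=
  if s = 0 then (q.2.1, 0) else if h : s < ℓ then (q.1, ⟨s, h⟩) else (q.2.2, 0)

/-- The graph in which each edge of `F` is replaced by a path of length `ℓ`. -/
def subdivision (ℓ : ℕ) [NeZero ℓ] (F : Set (Fin n × Fin n × Fin n)) :
    SimpleGraph (Fin n × Fin ℓ) :=
  SimpleGraph.fromRel fun x y =>
    ∃ q ∈ F, ∃ s < ℓ, x = pathVertex q s ∧ y = pathVertex q (s + 1)

/-- The edges of the list `e` with their indices. -/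
def indexedEdges (e : Fin n → Fin n × Fin n) : Set (Fin n × Fin n × Fin n) :=
  Set.range fun t => (t, e t)

theorem subdivision_mono {F F' : Set (Fin n × Fin n × Fin n)} (h : F ⊆ F') :
    subdivision ℓ F ≤ subdivision ℓ F' := by
  intro x y hxy
  rw [subdivision, SimpleGraph.fromRel_adj] at hxy ⊢
  refine ⟨hxy.1, hxy.2.imp ?_ ?_⟩ <;>
  exact fun ⟨q, hq, hs⟩ => ⟨q, h hq, hs⟩

/-- A lower bound for the distance of a vertex of the subdivision from the set `A` of original
vertices, truncated at `ℓ` for the original vertices. -/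
noncomputable def distanceBound (ℓ : ℕ) [NeZero ℓ] (e : Fin n → Fin n × Fin n) (A : Set (Fin n))
    (x : Fin n × Fin ℓ) : ℕ :=
  open Classical in
  if x.2 = 0 then (if x.1 ∈ A then 0 else ℓ)
  else min (x.2 + if (e x.1).1 ∈ A then 0 else ℓ) (ℓ - x.2 + if (e x.1).2 ∈ A then 0 else ℓ)

theorem pathVertex_zero (q : Fin n × Fin n × Fin n) : pathVertex (ℓ := ℓ) q 0 = (q.2.1, 0) :=
  if_pos rfl

theorem pathVertex_length (q : Fin n × Fin n × Fin n) : pathVertex (ℓ := ℓ) q ℓ = (q.2.2, 0) := by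
  rw [pathVertex, if_neg (NeZero.ne ℓ), dif_neg (lt_irrefl ℓ)]

theorem pathVertex_of_lt (q : Fin n × Fin n × Fin n) {s : ℕ} (h0 : s ≠ 0) (hs : s < ℓ) :
    pathVertex q s = (q.1, ⟨s, hs⟩) := by
  rw [pathVertex, if_neg h0, dif_pos hs]

open Classical in
-- Along a path, ends included, the case distinction in the definition becomes a single formula,
-- which visibly changes by at most one per step.
theorem distanceBound_pathVertex (e : Fin n → Fin n × Fin n) (A : Set (Fin n)) (t : Fin n) {s : ℕ}
    (hs : s ≤ ℓ) :
    distanceBound ℓ e A (pathVertex (t, e t) s) =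
      min (s + if (e t).1 ∈ A then 0 else ℓ) (ℓ - s + if (e t).2 ∈ A then 0 else ℓ) := by
  rcases Nat.eq_zero_or_pos s with rfl | h0
  · rw [pathVertex_zero, distanceBound, if_pos rfl]
    split_ifs <;> omega
  · rcases hs.lt_or_eq with h | rfl
    · rw [pathVertex_of_lt _ h0.ne' h, distanceBound, if_neg]
      rw [Fin.ext_iff]
      simpa using h0.ne'
    · rw [pathVertex_length, distanceBound, if_pos rfl]
      split_ifs <;> omega

/-- The edges of the list `e` that have an end in `A`, with their indices. -/
def edgesMeeting (e : Fin n → Fin n × Fin n) (A : Set (Fin n)) : Set (Fin n × Fin n × Fin n) :=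
  {q | ∃ t, ((e t).1 ∈ A ∨ (e t).2 ∈ A) ∧ q = (t, e t)}

/-- The bound is 1-Lipschitz, so it stays below `ℓ` on the ball. On the path of an edge with no end
in `A` it is at least `ℓ`; hence only paths of edges meeting `A` are used. -/
theorem subdivision_adj_edgesMeeting {V : Type*} (f : V → Fin n × Fin ℓ)
    (e : Fin n → Fin n × Fin n) (A : Set (Fin n)) {c : V} {r : ℕ}
    (hr : distanceBound ℓ e A (f c) + r < ℓ) (x y : V)
    (hx : ((subdivision ℓ (indexedEdges e)).comap f).edist c x ≤ r)
    (hxy : ((subdivision ℓ (indexedEdges e)).comap f).Adj x y) :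
    ((subdivision ℓ (edgesMeeting e A)).comap f).Adj x y := by
  classical
  have hlt : distanceBound ℓ e A (f x) < ℓ := by
    refine (le_add_of_edist_le (f := fun x => distanceBound ℓ e A (f x))
      (fun x y hxy => ?_) hx).trans_lt hr
    rw [SimpleGraph.comap_adj, subdivision, SimpleGraph.fromRel_adj] at hxy
    rcases hxy.2 with ⟨_, ⟨t, rfl⟩, s, hs, h₁, h₂⟩ | ⟨_, ⟨t, rfl⟩, s, hs, h₁, h₂⟩ <;>
    · simp only [h₁, h₂]
      rw [distanceBound_pathVertex e A t (by omega : s + 1 ≤ ℓ),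
        distanceBound_pathVertex e A t hs.le]
      omega
  rw [SimpleGraph.comap_adj, subdivision, SimpleGraph.fromRel_adj] at hxy ⊢
  refine ⟨hxy.1, ?_⟩
  have key : ∀ (t : Fin n) (s : ℕ), s ≤ ℓ → distanceBound ℓ e A (pathVertex (t, e t) s) < ℓ →
      (t, e t) ∈ edgesMeeting e A := by
    intro t s hs h
    refine ⟨t, ?_, rfl⟩
    rw [distanceBound_pathVertex e A t hs] at h
    by_contra hA
    rw [not_or] at hA
    rw [if_neg hA.1, if_neg hA.2] at h
    omega
  rcases hxy.2 with ⟨_, ⟨t, rfl⟩, s, hs, h₁, h₂⟩ | ⟨_, ⟨t, rfl⟩, s, hs, h₁, h₂⟩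
  · exact Or.inl ⟨_, key t s hs.le (h₁ ▸ hlt), s, hs, h₁, h₂⟩
  · exact Or.inr ⟨_, key t (s + 1) hs (h₂ ▸ hlt), s, hs, h₁, h₂⟩

/-- The original vertices next to a vertex of the subdivision. -/
def nearVertices (e : Fin n → Fin n × Fin n) (c : Fin n × Fin ℓ) : Set (Fin n) :=
  if c.2 = 0 then {c.1} else {(e c.1).1, (e c.1).2}

/-- The nearer end of a path is at distance at most `ℓ / 2`. With `2 * k < ℓ` this leaves room for a
ball of radius `k`. -/
theorem distanceBound_nearVertices (e : Fin n → Fin n × Fin n) (c : Fin n × Fin ℓ) :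
    2 * distanceBound ℓ e (nearVertices e c) c ≤ ℓ := by
  rw [distanceBound, nearVertices]
  split_ifs <;> simp_all
  omega

/-- A ball in a subdivision is determined by the edges near its center. -/
theorem subdivision_hopBall_eq {k : ℕ} (hk : 2 * k < ℓ) {V : Type*} (f : V → Fin n × Fin ℓ)
    (e : Fin n → Fin n × Fin n) (c : V) {r : ℕ} (hr : r ≤ k) :
    let G := (subdivision ℓ (indexedEdges e)).comap f
    let H := (subdivision ℓ (edgesMeeting e (nearVertices e (f c)))).comap f
    (⟨hopBall G c r, G.induce (hopBall G c r)⟩ : Σ S : Set V, SimpleGraph S) =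
      ⟨hopBall H c r, H.induce (hopBall H c r)⟩ := by
  have := distanceBound_nearVertices e (f c)
  refine hopBall_eq_of_le (fun x y hxy => ?_) c r
    (subdivision_adj_edgesMeeting f e (nearVertices e (f c)) (by omega))
  refine subdivision_mono ?_ hxy
  rintro _ ⟨t, -, rfl⟩
  exact ⟨t, rfl⟩

theorem ncard_edgeSet_subdivision_le {V : Type*} (f : V ≃ Fin n × Fin ℓ)
    (e : Fin n → Fin n × Fin n) :
    ((subdivision ℓ (indexedEdges e)).comap f).edgeSet.ncard ≤ n * ℓ := by
  have h : ((subdivision ℓ (indexedEdges e)).comap f).edgeSet ⊆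
      Set.range fun q : Fin n × Fin ℓ => s(f.symm (pathVertex (q.1, e q.1) q.2),
        f.symm (pathVertex (q.1, e q.1) (q.2 + 1))) := by
    intro z
    induction z with | _ x y =>
    rw [SimpleGraph.mem_edgeSet, SimpleGraph.comap_adj, subdivision, SimpleGraph.fromRel_adj]
    rintro ⟨-, ⟨_, ⟨t, rfl⟩, s, hs, h₁, h₂⟩ | ⟨_, ⟨t, rfl⟩, s, hs, h₁, h₂⟩⟩
    · refine ⟨(t, ⟨s, hs⟩), ?_⟩
      simp only [← h₁, ← h₂, Equiv.symm_apply_apply]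
    · refine ⟨(t, ⟨s, hs⟩), ?_⟩
      simp only [← h₁, ← h₂, Equiv.symm_apply_apply, Sym2.eq_swap]
  refine (Set.ncard_le_ncard h (Set.finite_range _)).trans ?_
  rw [← Set.image_univ]
  refine (Set.ncard_image_le Set.finite_univ).trans ?_
  simp [Set.ncard_univ]

theorem reachable_pathVertex {F : Set (Fin n × Fin n × Fin n)} {q : Fin n × Fin n × Fin n}
    (hq : q ∈ F) {s : ℕ} (hs : s ≤ ℓ) :
    (subdivision ℓ F).Reachable (q.2.1, 0) (pathVertex q s) := by
  induction s with
  | zero => rw [pathVertex_zero]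
  | succ s ih =>
    refine (ih (by omega)).trans ?_
    by_cases h : (pathVertex q s : Fin n × Fin ℓ) = pathVertex q (s + 1)
    · rw [h]
    · refine SimpleGraph.Adj.reachable ?_
      rw [subdivision, SimpleGraph.fromRel_adj]
      exact ⟨h, Or.inl ⟨q, hq, s, hs, rfl, rfl⟩⟩

theorem subdivision_connected {G : SimpleGraph (Fin n)} {e : Fin n → Fin n × Fin n}
    (he : IsEdgeEncoding G e) (hG : G.Connected) :
    (subdivision ℓ (indexedEdges e)).Connected := by
  have hadj : ∀ u v, G.Adj u v → (subdivision ℓ (indexedEdges e)).Reachable (u, 0) (v, 0) := by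
    intro u v huv
    have : s(u, v) ∈ G.edgeSet := huv
    rw [← he.2] at this
    obtain ⟨t, ht⟩ := this
    have h := reachable_pathVertex (ℓ := ℓ) (F := indexedEdges e) ⟨t, rfl⟩ le_rfl
    rw [pathVertex_length] at h
    rcases Sym2.eq_iff.1 ht with ⟨h₁, h₂⟩ | ⟨h₁, h₂⟩
    · rwa [h₁, h₂] at h
    · rw [h₁, h₂] at h
      exact h.symm
  have horig : ∀ u v, (subdivision ℓ (indexedEdges e)).Reachable (u, 0) (v, 0) := by
    intro u v
    obtain ⟨p⟩ := hG.preconnected u v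
    induction p with
    | nil => rfl
    | cons h _ ih => exact (hadj _ _ h).trans ih
  have hall : ∀ x : Fin n × Fin ℓ, ∃ u, (subdivision ℓ (indexedEdges e)).Reachable (u, 0) x := by
    intro x
    by_cases hx : x.2 = 0
    · exact ⟨x.1, by rw [← hx]⟩
    · refine ⟨(e x.1).1, ?_⟩
      have h := reachable_pathVertex (ℓ := ℓ) (F := indexedEdges e) ⟨x.1, rfl⟩ x.2.2.le
      rwa [pathVertex_of_lt _ (fun h => hx (Fin.ext h)) x.2.2] at h
  obtain ⟨u⟩ := hG.nonempty
  rw [SimpleGraph.connected_iff]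
  refine ⟨fun x y => ?_, ⟨(u, 0)⟩⟩
  obtain ⟨v, hv⟩ := hall x
  obtain ⟨w, hw⟩ := hall y
  exact hv.symm.trans ((horig v w).trans hw)

theorem not_connected_of_invariant {V : Type*} {G : SimpleGraph V} (c : V → Bool)
    (hc : ∀ x y, G.Adj x y → c x = c y) {u v : V} (huv : c u ≠ c v) : ¬ G.Connected := by
  intro hG
  obtain ⟨p⟩ := hG.preconnected u v
  induction p with
  | nil => exact huv rfl
  | cons h _ ih => exact ih (fun h' => huv ((hc _ _ h).trans h'))

theorem subdivision_not_connected {e : Fin n → Fin n × Fin n} (c : Fin n → Bool)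
    (hc : ∀ t, c (e t).1 = c (e t).2) {u v : Fin n} (huv : c u ≠ c v) :
    ¬ (subdivision ℓ (indexedEdges e)).Connected := by
  -- The coloring of the original vertices extends to the interior of each path by the color of its
  -- first end.
  have key : ∀ t (s : ℕ), s ≤ ℓ → (fun x : Fin n × Fin ℓ =>
      if x.2 = 0 then c x.1 else c (e x.1).1) (pathVertex (t, e t) s) = c (e t).1 := by
    intro t s hs
    rcases Nat.eq_zero_or_pos s with rfl | h0
    · simp [pathVertex_zero]
    · rcases hs.lt_or_eq with h | rfl
      · rw [pathVertex_of_lt _ h0.ne' h]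
        simp [Fin.ext_iff, h0.ne']
      · simp [pathVertex_length, hc]
  refine not_connected_of_invariant (fun x : Fin n × Fin ℓ =>
      if x.2 = 0 then c x.1 else c (e x.1).1) (fun x y hxy => ?_) (u := (u, 0)) (v := (v, 0))
      (by simpa using huv)
  rw [subdivision, SimpleGraph.fromRel_adj] at hxy
  rcases hxy.2 with ⟨_, ⟨t, rfl⟩, s, hs, rfl, rfl⟩ | ⟨_, ⟨t, rfl⟩, s, hs, rfl, rfl⟩
  · exact (key t s hs.le).trans (key t (s + 1) hs).symm
  · exact (key t (s + 1) hs).trans (key t s hs.le).symm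

end Subdivision

/-! ## One cycle and two cycles -/

/-- The edge lists of single cycles and of pairs of cycles. -/
def cycleInputs (n : ℕ) : Set (Fin n → Fin n × Fin n) :=
  {e | ∃ G, IsEdgeEncoding G e ∧ (IsOneCycle G ∨ IsTwoCycles G)}

theorem ncard_neighborSet_cycleGraph_le {n : ℕ} (v : Fin n) :
    ((SimpleGraph.cycleGraph n).neighborSet v).ncard ≤ 2 := by
  match n with
  | 0 => exact v.elim0
  | 1 => exact (Set.ncard_le_card _).trans (by simp)
  | n + 2 =>
    rw [SimpleGraph.cycleGraph_neighborSet]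
    exact (Set.ncard_insert_le _ _).trans (by simp)

theorem ncard_neighborSet_iso {V W : Type*} {G : SimpleGraph V} {H : SimpleGraph W} (f : G ≃g H)
    (v : V) : (G.neighborSet v).ncard = (H.neighborSet (f v)).ncard :=
  Nat.card_congr (f.mapNeighborSet v)

theorem ncard_neighborSet_le_of_cycles {n : ℕ} {G : SimpleGraph (Fin n)}
    (h : IsOneCycle G ∨ IsTwoCycles G) (v : Fin n) : (G.neighborSet v).ncard ≤ 2 := by
  rcases h with h | h <;> obtain ⟨f⟩ := h
  · rw [ncard_neighborSet_iso f]
    exact ncard_neighborSet_cycleGraph_le _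
  · rw [ncard_neighborSet_iso f]
    rcases f v with w | w
    · rw [SimpleGraph.neighborSet_sum_inl]
      exact (Set.ncard_image_le (Set.toFinite _)).trans (ncard_neighborSet_cycleGraph_le w)
    · rw [SimpleGraph.neighborSet_sum_inr]
      exact (Set.ncard_image_le (Set.toFinite _)).trans (ncard_neighborSet_cycleGraph_le w)

theorem ncard_incident_le {n : ℕ} {e : Fin n → Fin n × Fin n} (he : e ∈ cycleInputs n)
    (u : Fin n) : {t | (e t).1 = u ∨ (e t).2 = u}.ncard ≤ 2 := by
  obtain ⟨G, ⟨hinj, hrange⟩, hG⟩ := he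
  refine le_trans ?_ (ncard_neighborSet_le_of_cycles hG u)
  have hs : ∀ t, (e t).1 = u ∨ (e t).2 = u →
      s((e t).1, (e t).2) = s(u, if (e t).1 = u then (e t).2 else (e t).1) := by
    intro t ht
    split_ifs with h
    · rw [h]
    · rw [ht.resolve_left h, Sym2.eq_swap]
  refine Set.ncard_le_ncard_of_injOn (fun t => if (e t).1 = u then (e t).2 else (e t).1)
    (fun t ht => ?_) (fun t ht t' ht' h => ?_) (Set.toFinite _)
  · have : s((e t).1, (e t).2) ∈ G.edgeSet := hrange ▸ ⟨t, rfl⟩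
    rwa [hs t ht] at this
  · apply hinj
    dsimp only at h ⊢
    rw [hs t ht, hs t' ht', h]

theorem ncard_edgesMeeting_le {n ℓ : ℕ} [NeZero ℓ] {e : Fin n → Fin n × Fin n}
    (he : e ∈ cycleInputs n) (c : Fin n × Fin ℓ) :
    (edgesMeeting e (nearVertices e c)).ncard ≤ 4 := by
  obtain ⟨u, v, huv⟩ : ∃ u v, nearVertices e c ⊆ {u, v} := by
    rw [nearVertices]
    split_ifs
    · exact ⟨c.1, c.1, by simp⟩
    · exact ⟨_, _, le_rfl⟩
  have h : edgesMeeting e (nearVertices e c) ⊆ (fun t => (t, e t)) ''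
      ({t | (e t).1 = u ∨ (e t).2 = u} ∪ {t | (e t).1 = v ∨ (e t).2 = v}) := by
    rintro _ ⟨t, ht, rfl⟩
    refine ⟨t, ?_, rfl⟩
    rcases ht with ht | ht
    · rcases huv ht with h | h
      · exact Or.inl (Or.inl h)
      · exact Or.inr (Or.inl h)
    · rcases huv ht with h | h
      · exact Or.inl (Or.inr h)
      · exact Or.inr (Or.inr h)
  refine (Set.ncard_le_ncard h (Set.toFinite _)).trans ((Set.ncard_image_le (Set.toFinite _)).trans
    ((Set.ncard_union_le _ _).trans ?_))
  exact add_le_add (ncard_incident_le he u) (ncard_incident_le he v)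

theorem IsOneCycle.connected {n : ℕ} (hn : n ≠ 0) {G : SimpleGraph (Fin n)} (h : IsOneCycle G) :
    G.Connected := by
  obtain ⟨f⟩ := h
  obtain ⟨n, rfl⟩ := Nat.exists_eq_succ_of_ne_zero hn
  exact f.connected_iff.2 SimpleGraph.cycleGraph_connected

theorem IsTwoCycles.exists_invariant {n : ℕ} (hn : 2 ≤ n) {G : SimpleGraph (Fin n)}
    (h : IsTwoCycles G) {e : Fin n → Fin n × Fin n} (he : IsEdgeEncoding G e) :
    ∃ c : Fin n → Bool, (∀ t, c (e t).1 = c (e t).2) ∧ ∃ u v, c u ≠ c v := by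
  obtain ⟨f⟩ := h
  have h0 : 0 < n / 2 := by omega
  refine ⟨fun u => (f u).isLeft, fun t => ?_, f.symm (Sum.inl ⟨0, h0⟩), f.symm (Sum.inr ⟨0, h0⟩),
    by simp⟩
  have hadj : s((e t).1, (e t).2) ∈ G.edgeSet := he.2 ▸ ⟨t, rfl⟩
  rw [SimpleGraph.mem_edgeSet, ← f.map_adj_iff] at hadj
  rcases h₁ : f (e t).1 with a | a <;> rcases h₂ : f (e t).2 with b | b <;>
    simp_all

/-! ## Simulation of transformers by protocols -/

/-- The elements are listed in `r` slots, each holding an element or nothing. -/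
theorem codedBy_of_ncard_le {𝒳 α Ω : Type*} [Fintype α] [Fintype Ω] {r : ℕ} (ψ : 𝒳 → Set α)
    (hψ : ∀ e, (ψ e).ncard ≤ r) (hΩ : (Fintype.card α + 1) ^ r ≤ Fintype.card Ω) :
    CodedBy Ω ψ := by
  classical
  have key : ∀ e, ∃ f : Fin r → Option α, ∀ a, a ∈ ψ e ↔ ∃ i, f i = some a := by
    intro e
    have hfin : (ψ e).Finite := Set.toFinite _
    have hlen : hfin.toFinset.toList.length ≤ r := by
      rw [Finset.length_toList, ← Set.ncard_eq_toFinset_card]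
      exact hψ e
    refine ⟨fun i => hfin.toFinset.toList[i.1]?, fun a => ?_⟩
    rw [← hfin.mem_toFinset, ← Finset.mem_toList, List.mem_iff_getElem?]
    constructor
    · rintro ⟨i, hi⟩
      exact ⟨⟨i, (List.getElem?_eq_some_iff.1 hi).1.trans_le hlen⟩, hi⟩
    · rintro ⟨i, hi⟩
      exact ⟨i, hi⟩
  choose f hf using key
  refine CodedBy.of_factors (codedBy_of_card_le f (by simpa using hΩ)) fun e e' h => ?_
  ext a
  rw [hf, hf, h]

/-- Whether edge `t` is near `c` depends on the edges `t` and `c.1` only, and the union over `t` is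
aggregated. Partial unions have at most four elements because the inputs are cycles. -/
theorem Comp.edgesMeeting {n ℓ d a : ℕ} [NeZero ℓ] [NeZero d] {ι Ω : Type} [Fintype Ω] (hd : 2 ≤ d)
    (hΩ : (n ^ 3 + 1) ^ 4 ≤ Fintype.card Ω) (hn : n ≤ d ^ a) {x : cycleInputs n → ι → Ω}
    {pl : Fin n → ι} (hx : ∀ t e e', x e (pl t) = x e' (pl t) → e.1 t = e'.1 t)
    (c : Fin n × Fin ℓ) :
    Comp d x (1 + a) fun e => edgesMeeting e.1 (nearVertices e.1 c) := by
  have : Nonempty ι := ⟨pl c.1⟩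
  have hcode : ∀ t, CodedBy Ω fun e : cycleInputs n => e.1 t := fun t => ⟨fun e => x e (pl t), hx t⟩
  have hproj : ∀ t, Comp d x 0 fun e : cycleInputs n => e.1 t := fun t => Comp.proj 0 (pl t) (hx t)
  let Φ : Finset (Fin n) → cycleInputs n → Set (Fin n × Fin n × Fin n) := fun s e =>
    {q | ∃ t ∈ s, ((e.1 t).1 ∈ nearVertices e.1 c ∨ (e.1 t).2 ∈ nearVertices e.1 c) ∧
      q = (t, e.1 t)}
  have hΦ : ∀ s, CodedBy Ω (Φ s) := by
    refine fun s => codedBy_of_ncard_le (r := 4) _ (fun e => ?_) ?_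
    swap
    · simpa [← pow_succ', ← sq, ← pow_succ] using hΩ
    refine (Set.ncard_le_ncard ?_ (Set.toFinite _)).trans (ncard_edgesMeeting_le e.2 c)
    rintro _ ⟨t, -, h⟩
    exact ⟨t, h⟩
  refine (Comp.aggregate (D := 1) (D' := a) (s := Finset.univ) hΦ (fun e e' => ?_) (fun s hs => ?_)
    (fun s t e e' _ h₁ h₂ u hu => ?_) (by simpa using hn)).of_factors fun e e' h => ?_
  · simp [Φ]
  · rcases Nat.le_one_iff_eq_zero_or_eq_one.1 hs with hs | hs
    · rw [Finset.card_eq_zero] at hs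
      subst hs
      exact Comp.const fun _ _ => by simp [Φ]
    · obtain ⟨t, rfl⟩ := Finset.card_eq_one.1 hs
      refine (Comp.pair hd (hproj c.1) (hcode c.1) (hproj t) (hcode t)).of_factors fun e e' h => ?_
      obtain ⟨h₁, h₂⟩ := Prod.mk.inj h
      simp only [Φ, Finset.mem_singleton, exists_eq_left, nearVertices, h₁, h₂]
  · have key : ∀ e, Φ u e = Φ s e ∪ Φ t e := by
      intro e
      ext q
      simp only [Φ, Set.mem_union, Set.mem_ofPred_eq, hu, or_and_right, exists_or]
    rw [key, key, h₁, h₂]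
  · simpa [Φ, _root_.edgesMeeting] using h

theorem distinguishesCycles_of_forall {n : ℕ} {P : MPCProtocol n} {b : cycleInputs n → Bool}
    (hP : ∀ e : cycleInputs n, P.RespectsMemory e.1 ∧ P.result e.1 = b e)
    (h₁ : ∀ (e : cycleInputs n) G, IsEdgeEncoding G e.1 → IsOneCycle G → b e = true)
    (h₂ : ∀ (e : cycleInputs n) G, IsEdgeEncoding G e.1 → IsTwoCycles G → b e = false) :
    P.DistinguishesCycles := by
  refine fun G e he => ⟨fun hG => ?_, fun hG => ?_⟩
  · have h := hP ⟨e, G, he, Or.inl hG⟩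
    rwa [h₁ _ G he hG] at h
  · have h := hP ⟨e, G, he, Or.inr hG⟩
    rwa [h₂ _ G he hG] at h

theorem exists_protocol_of_localTransformer {n k p m L H N W d a b D D' : ℕ} (hn : 2 ≤ n)
    (hN : n * (2 * k + 2) ≤ N) (A : LocalTransformer k p m L H) (hA : A.SolvesConnectivity N)
    {T : ℕ} (hT : A.numTokens (n * (2 * k + 2)) = T) (hd : 3 ≤ d)
    (hW : 2 * ((T + m + H) * 16 ^ p) + 1 ≤ W) (hW' : (n ^ 3 + 1) ^ 4 ≤ W) (hTd : T ≤ d ^ a)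
    (hnd : n ≤ d ^ a) (hH : H ≤ d ^ b) (hD : D = 1 + a + 1 + a + b + 1)
    (hD' : (n + T) * d ^ (D + 1) ≤ d ^ D') :
    ∃ P : MPCProtocol n, P.DistinguishesCycles ∧
      Fintype.card P.Machine = (n + T) * d ^ D * d ^ D' ∧ P.wordSize = W ∧
      P.memory = d * (m + 1) ∧ P.rounds = (L + 1) * (D + 1) * (D' + 1) := by
  subst hT hD
  set T := A.numTokens (n * (2 * k + 2)) with hT
  set D := 1 + a + 1 + a + b + 1 with hD
  have : NeZero d := ⟨by omega⟩
  have : NeZero n := ⟨by omega⟩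
  have hv : 0 < n * (2 * k + 2) := by positivity
  have hWn : n ^ 3 ≤ W := by
    refine le_trans ?_ hW'
    calc n ^ 3 ≤ n ^ 3 + 1 := Nat.le_succ _
      _ ≤ (n ^ 3 + 1) ^ 4 := Nat.le_self_pow (by norm_num) _
  have hWn' : n ≤ W := (Nat.le_self_pow (by norm_num) n).trans hWn
  have : NeZero W := ⟨by omega⟩
  have hcard : W ≤ Fintype.card (Fin (m + 1) → Fin W) := by
    simpa using Nat.le_self_pow (Nat.succ_ne_zero m) W
  obtain ⟨encE⟩ : Nonempty (Fin n × Fin n ↪ (Fin (m + 1) → Fin W)) := by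
    refine Function.Embedding.nonempty_of_card_le (le_trans ?_ hcard)
    refine le_trans ?_ hWn
    simpa [pow_succ] using Nat.le_mul_of_pos_right (n * n) (by omega : 0 < n)
  obtain ⟨enc, henc⟩ : ∃ enc : (Fin m → Fixed p) → Fin (m + 1) → Fin W, Function.Injective enc := by
    -- For `m = 0` there is only one embedding; otherwise `hW` makes a word large enough for a
    -- single coordinate.
    by_cases hm : m = 0
    · subst hm
      exact ⟨fun _ => default, fun _ _ _ => funext fun i => i.elim0⟩
    · refine exists_injective_code (le_trans ?_ hW)
      have h₁ : 4 ^ p ≤ 16 ^ p := Nat.pow_le_pow_left (by norm_num) p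
      have h₂ : 1 * 16 ^ p ≤ (T + m + H) * 16 ^ p := Nat.mul_le_mul_right _ (by omega)
      omega
  let σ : Fin (n * (2 * k + 2)) ≃ Fin n × Fin (2 * k + 2) := finProdFinEquiv.symm
  let G : cycleInputs n → SimpleGraph (Fin (n * (2 * k + 2))) := fun e =>
    (subdivision (2 * k + 2) (indexedEdges e.1)).comap σ
  let E := A.encoding (n * (2 * k + 2))
  let F := A.transformer (n * (2 * k + 2))
  let Y : cycleInputs n → Fin T → Fin m → Fixed p := fun e => E.tokens (G e)
  let x : cycleInputs n → Fin n ⊕ Fin T → Fin (m + 1) → Fin W := fun e =>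
    Sum.elim (fun t => encE (e.1 t)) fun _ => default
  have hx : ∀ t e e', x e (Sum.inl t) = x e' (Sum.inl t) → e.1 t = e'.1 t :=
    fun t e e' h => encE.injective h
  have hstep : CompStep d D x (tokenState n enc Y) := by
    have : Nonempty (Fin n ⊕ Fin T) := ⟨Sum.inl 0⟩
    refine compStep_tokenState fun t => ?_
    refine ((Comp.edgesMeeting (by omega) (hW'.trans hcard) hnd hx (σ (E.center t))).mono
      (by omega)).of_factors fun e e' h => ?_
    have hball := fun e : cycleInputs n => subdivision_hopBall_eq (by omega : 2 * k < 2 * k + 2) σ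
      e.1 (E.center t) (E.radius_le t)
    -- Inputs with the same edges near the center give the same labelled ball, hence the same token.
    have heq := (hball e).trans (Eq.trans (by rw [h]) (hball e').symm)
    exact congrArg (E.encoder t) heq
  have hiter : IterRel (CompStep d D) (1 + L) x (tokenState n enc fun e => F.eval (Y e)) :=
    (IterRel.single hstep).trans (iterRel_compStep_eval hd hW hTd hH henc F Y)
  let o := A.out (n * (2 * k + 2)) hv
  obtain ⟨P, hP₁, hP₂, hP₃, hP₄, hP⟩ := exists_protocol_of_compStep (D' := D') hWn'
    (Nat.le_add_left 1 m) (by omega) (by simpa using hD') (Sum.inl_injective)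
    (fun t e e' h => by simp only [x, Sum.elim_inl, h])
    (fun v hv e e' => by
      rcases v with t | t
      · exact absurd ⟨t, rfl⟩ hv
      · rfl) hiter (Sum.inr o) (fun e => A.decision hv (G e))
    (fun e e' h => by
      have : F.eval (Y e) o = F.eval (Y e') o := henc h
      change A.readout _ (F.eval (Y e) o) = A.readout _ (F.eval (Y e') o)
      rw [this])
  have hdec : ∀ e, A.decision hv (G e) = true ↔ (G e).Connected := fun e =>
    hA _ hv hN (G e) ((ncard_edgeSet_subdivision_le σ e.1).trans hN)
  have hconn : ∀ e, (G e).Connected ↔ (subdivision (2 * k + 2) (indexedEdges e.1)).Connected :=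
    fun e => (SimpleGraph.Iso.comap σ _).connected_iff
  refine ⟨P, distinguishesCycles_of_forall hP (fun e G' he hG => ?_) (fun e G' he hG => ?_),
    by simpa using hP₁, hP₂, hP₃, by rw [hP₄, add_comm 1 L]⟩
  · rw [hdec, hconn]
    exact subdivision_connected he (hG.connected (by omega))
  · obtain ⟨c, hc, u, v, huv⟩ := hG.exists_invariant hn he
    rw [Bool.eq_false_iff, Ne, hdec, hconn]
    exact subdivision_not_connected c hc huv

/-! ## A protocol that distinguishes cycles with little memory -/

theorem IsTwoCycles.exists_incident {n : ℕ} (hn : 4 ≤ n) {G : SimpleGraph (Fin n)}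
    (h : IsTwoCycles G) {e : Fin n → Fin n × Fin n} (he : IsEdgeEncoding G e) (v : Fin n) :
    ∃ t, (e t).1 = v ∨ (e t).2 = v := by
  obtain ⟨f⟩ := h
  have hcycle : ∀ w : Fin (n / 2), ∃ w', (SimpleGraph.cycleGraph (n / 2)).Adj w w' := by
    obtain ⟨k, hk⟩ : ∃ k, n / 2 = k + 2 := ⟨n / 2 - 2, by omega⟩
    rw [hk]
    refine fun w => ⟨w + 1, ?_⟩
    rw [← SimpleGraph.mem_neighborSet, SimpleGraph.cycleGraph_neighborSet]
    exact Or.inr rfl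
  obtain ⟨w, hw⟩ : ∃ w, G.Adj v w := by
    rcases hv : f v with a | a <;> obtain ⟨b, hb⟩ := hcycle a
    · refine ⟨f.symm (Sum.inl b), ?_⟩
      rw [← f.map_adj_iff, hv, f.apply_symm_apply]
      exact SimpleGraph.sum_adj_inl.2 hb
    · refine ⟨f.symm (Sum.inr b), ?_⟩
      rw [← f.map_adj_iff, hv, f.apply_symm_apply]
      exact SimpleGraph.sum_adj_inr.2 hb
  have : s(v, w) ∈ G.edgeSet := hw
  rw [← he.2] at this
  obtain ⟨t, ht⟩ := this
  refine ⟨t, ?_⟩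
  rcases Sym2.eq_iff.1 ht with h | h
  · exact Or.inl h.1
  · exact Or.inr h.2

/-- The two edges have a common end. -/
def EdgesMeet {n : ℕ} (a b : Fin n × Fin n) : Prop :=
  a.1 = b.1 ∨ a.1 = b.2 ∨ a.2 = b.1 ∨ a.2 = b.2

/-- The edge `i` of the list can be reached from the first edge through `r` common ends. -/
def ReachedIn {n : ℕ} [NeZero n] (e : Fin n → Fin n × Fin n) : ℕ → Fin n → Prop
  | 0, i => i = 0
  | r + 1, i => ∃ j, ReachedIn e r j ∧ EdgesMeet (e j) (e i)

theorem ReachedIn.succ {n : ℕ} [NeZero n] {e : Fin n → Fin n × Fin n} {r : ℕ} {i : Fin n}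
    (h : ReachedIn e r i) : ReachedIn e (r + 1) i :=
  ⟨i, h, Or.inl rfl⟩

theorem ReachedIn.mono {n : ℕ} [NeZero n] {e : Fin n → Fin n × Fin n} {r r' : ℕ} {i : Fin n}
    (h : ReachedIn e r i) (hr : r ≤ r') : ReachedIn e r' i := by
  induction hr with
  | refl => exact h
  | step _ ih => exact ih.succ

theorem ReachedIn.invariant {n : ℕ} [NeZero n] {e : Fin n → Fin n × Fin n} {c : Fin n → Bool}
    (hc : ∀ t, c (e t).1 = c (e t).2) {r : ℕ} {i : Fin n} (h : ReachedIn e r i) :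
    c (e i).1 = c (e 0).1 := by
  induction r generalizing i with
  | zero => rw [show i = 0 from h]
  | succ r ih =>
    obtain ⟨j, hj, hji⟩ := h
    rw [← ih hj]
    rcases hji with h | h | h | h
    · rw [h]
    · rw [hc i, h]
    · rw [hc j, h]
    · rw [hc i, hc j, h]

theorem exists_reachedIn {n : ℕ} [NeZero n] {G : SimpleGraph (Fin n)} {e : Fin n → Fin n × Fin n}
    (he : IsEdgeEncoding G e) (hG : G.Connected) (i : Fin n) : ∃ r, ReachedIn e r i := by
  have key : ∀ u v, G.Walk u v → (∃ r j, ReachedIn e r j ∧ ((e j).1 = u ∨ (e j).2 = u)) →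
      ∃ r j, ReachedIn e r j ∧ ((e j).1 = v ∨ (e j).2 = v) := by
    intro u v p
    induction p with
    | nil => exact id
    | @cons u w _ huw _ ih =>
      rintro ⟨r, j, hj, hju⟩
      apply ih
      have : s(u, w) ∈ G.edgeSet := huw
      rw [← he.2] at this
      obtain ⟨t, ht⟩ := this
      refine ⟨r + 1, t, ⟨j, hj, ?_⟩, ?_⟩
      · rcases Sym2.eq_iff.1 ht with ⟨h₁, -⟩ | ⟨-, h₂⟩
        · rcases hju with h | h
          · exact Or.inl (h.trans h₁.symm)
          · exact Or.inr (Or.inr (Or.inl (h.trans h₁.symm)))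
        · rcases hju with h | h
          · exact Or.inr (Or.inl (h.trans h₂.symm))
          · exact Or.inr (Or.inr (Or.inr (h.trans h₂.symm)))
      · rcases Sym2.eq_iff.1 ht with ⟨-, h⟩ | ⟨h, -⟩
        · exact Or.inr h
        · exact Or.inl h
  obtain ⟨p⟩ := hG.preconnected (e 0).1 (e i).1
  obtain ⟨r, j, hj, hji⟩ := key _ _ p ⟨0, 0, rfl, Or.inl rfl⟩
  refine ⟨r + 1, j, hj, ?_⟩
  rcases hji with h | h
  · exact Or.inl h
  · exact Or.inr (Or.inr (Or.inl h))

/-- Flooding from the first edge: each node keeps its edge and one bit, whence `2 * n ^ 2 ≤ W`. The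
number of rounds is irrelevant, because this protocol only shows that the memory bounds can be met.
-/
theorem exists_protocol_of_small_memory {n d a W D' : ℕ} (hn : 4 ≤ n) (hd : 2 ≤ d)
    (hnd : n ≤ d ^ a) (hW : 2 * n ^ 2 ≤ W) (hD' : n * d ^ (1 + a + 1 + 1) ≤ d ^ D') :
    ∃ P : MPCProtocol n, P.DistinguishesCycles ∧
      Fintype.card P.Machine = n * d ^ (1 + a + 1) * d ^ D' ∧ P.wordSize = W ∧
      P.memory = d := by
  classical
  have : NeZero d := ⟨by omega⟩
  have : NeZero n := ⟨by omega⟩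
  have hWn : n ≤ W := by nlinarith
  have : NeZero W := ⟨by omega⟩
  let Ω := Fin 1 → Fin W
  have hΩ : Fintype.card Ω = W := by simp [Ω]
  obtain ⟨enc⟩ : Nonempty ((Fin n × Fin n) × Prop ↪ Ω) := by
    refine Function.Embedding.nonempty_of_card_le ?_
    rw [hΩ]
    simpa [mul_comm, ← sq] using hW
  have hProp : ∀ φ : cycleInputs n → Prop, CodedBy Ω φ := fun φ =>
    codedBy_of_card_le φ (by rw [hΩ]; simp; omega)
  let x : ℕ → cycleInputs n → Fin n → Ω := fun r e i => enc (e.1 i, ReachedIn e.1 r i)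
  have hcode : ∀ r i, CodedBy Ω fun e : cycleInputs n => (e.1 i, ReachedIn e.1 r i) := fun r i =>
    ⟨fun e => x r e i, fun e e' h => enc.injective h⟩
  have hproj : ∀ r i D, Comp d (x r) D fun e : cycleInputs n => (e.1 i, ReachedIn e.1 r i) :=
    fun r i D => Comp.proj D i fun e e' h => enc.injective h
  have hstep : ∀ r, CompStep d (1 + a + 1) (x r) (x (r + 1)) := by
    intro r i
    have hagg : Comp d (x r) (1 + a) fun e : cycleInputs n => ReachedIn e.1 (r + 1) i := by
      refine (Comp.aggregate (Φ := fun s (e : cycleInputs n) =>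
        ∃ j ∈ s, ReachedIn e.1 r j ∧ EdgesMeet (e.1 j) (e.1 i)) (s := Finset.univ)
        (fun s => hProp _) (fun _ _ => by simp) (fun s hs => ?_)
        (fun s t e e' _ h₁ h₂ u hu => ?_) (by simpa using hnd)).of_factors fun e e' h => ?_
      · rcases Nat.le_one_iff_eq_zero_or_eq_one.1 hs with hs | hs
        · rw [Finset.card_eq_zero] at hs
          subst hs
          exact Comp.const fun _ _ => by simp
        · obtain ⟨j, rfl⟩ := Finset.card_eq_one.1 hs
          refine (Comp.pair hd (hproj r i 0) (hcode r i) (hproj r j 0) (hcode r j)).of_factors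
            fun e e' h => ?_
          simp only [Prod.mk.injEq] at h
          simp only [Finset.mem_singleton, exists_eq_left, h]
      · simp only [hu, or_and_right, exists_or]
        rw [h₁, h₂]
      · simpa [ReachedIn] using h
    refine (Comp.pair hd (hproj r i (1 + a)) (hcode r i) hagg (hProp _)).of_factors
      fun e e' h => ?_
    simp only [Prod.mk.injEq] at h
    simp only [x, h]
  have hfinal : ∀ r, CompStep d (1 + a + 1) (x r)
      fun e _ => enc ((0, 0), ∀ j, ReachedIn e.1 r j) := by
    intro r i
    have hagg : Comp d (x r) (0 + a) fun e : cycleInputs n => ∀ j, ReachedIn e.1 r j := by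
      refine (Comp.aggregate (Φ := fun s (e : cycleInputs n) => ∀ j ∈ s, ReachedIn e.1 r j)
        (s := Finset.univ) (fun s => hProp _) (fun _ _ => by simp) (fun s hs => ?_)
        (fun s t e e' _ h₁ h₂ u hu => ?_) (by simpa using hnd)).of_factors fun e e' h => ?_
      · rcases Nat.le_one_iff_eq_zero_or_eq_one.1 hs with hs | hs
        · rw [Finset.card_eq_zero] at hs
          subst hs
          exact Comp.const fun _ _ => by simp
        · obtain ⟨j, rfl⟩ := Finset.card_eq_one.1 hs
          refine (hproj r j 0).of_factors fun e e' h => ?_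
          simp only [Prod.mk.injEq] at h
          simp only [Finset.mem_singleton, forall_eq, h]
      · simp only [hu, or_imp, forall_and]
        rw [h₁, h₂]
      · simpa using h
    refine (hagg.mono (by omega)).of_factors fun e e' h => ?_
    simp only [h]
  have hiter : ∀ r, IterRel (CompStep d (1 + a + 1)) r (x 0) (x r) := by
    intro r
    induction r with
    | zero => rfl
    | succ r ih => exact ⟨_, ih, hstep r⟩
  -- There are finitely many inputs and edges and reachability is monotone in `r`, so one `R` serves
  -- all.
  obtain ⟨R, hR⟩ : ∃ R, ∀ (e : cycleInputs n) i, (∃ r, ReachedIn e.1 r i) → ReachedIn e.1 R i := by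
    refine Eventually.exists (f := atTop) ?_
    rw [eventually_all]
    intro e
    rw [eventually_all]
    intro i
    by_cases h : ∃ r, ReachedIn e.1 r i
    · obtain ⟨r, hr⟩ := h
      filter_upwards [eventually_ge_atTop r] with r' hr' _ using hr.mono hr'
    · exact Eventually.of_forall fun _ h' => absurd h' h
  have hR' : IterRel (CompStep d (1 + a + 1)) (R + 1) (x 0)
      fun e _ => enc ((0, 0), ∀ j, ReachedIn e.1 R j) := ⟨_, hiter R, hfinal R⟩
  obtain ⟨P, hP₁, hP₂, hP₃, -, hP⟩ := exists_protocol_of_compStep (D' := D') hWn le_rfl hd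
    (by simpa using hD') Function.injective_id
    (fun t e e' h => by simp only [x, id, h, ReachedIn])
    (fun v hv => absurd ⟨v, rfl⟩ hv) hR' 0
    (fun e => decide (∀ j, ReachedIn e.1 R j))
    (fun e e' h => by
      have := enc.injective h
      simp only [Prod.mk.injEq, true_and] at this
      simp only [this])
  refine ⟨P, distinguishesCycles_of_forall hP (fun e G he hG => ?_) (fun e G he hG => ?_),
    by simpa using hP₁, hP₂, by simpa using hP₃⟩
  · rw [decide_eq_true_iff]
    exact fun j => hR e j (exists_reachedIn he (hG.connected (by omega)) j)
  · rw [decide_eq_false_iff_not]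
    intro h
    obtain ⟨c, hc, u, v, huv⟩ := hG.exists_invariant (by omega) he
    -- Flooding never changes the color and every vertex lies on an edge; reaching all edges would
    -- make the coloring constant.
    have hall : ∀ w, c w = c (e.1 0).1 := by
      intro w
      obtain ⟨t, ht⟩ := hG.exists_incident hn he w
      rw [← (h t).invariant hc]
      rcases ht with rfl | rfl
      · rfl
      · exact (hc t).symm
    exact huv ((hall u).trans (hall v).symm)

/-! ## The conjecture for single protocols -/

/-- The protocol satisfies the bounds of the conjecture for one `n` with explicit constants. -/
def MPCProtocol.IsBounded {n : ℕ} (P : MPCProtocol n) (δ : ℝ) (γ : ℕ) (B : ℝ) : Prop :=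
  P.DistinguishesCycles ∧ (P.memory : ℝ) ≤ B * (n : ℝ) ^ δ ∧
    (Fintype.card P.Machine : ℝ) ≤ B * (n : ℝ) ^ γ ∧ (P.wordSize : ℝ) ≤ B * (n : ℝ) ^ γ

/-- A protocol that does nothing. -/
def trivialProtocol (n : ℕ) : MPCProtocol n where
  Machine := Unit
  wordSize := n
  le_wordSize := le_rfl
  memory := 0
  rounds := 0
  home := fun _ => ()
  send := fun _ _ _ _ => []
  out := ()
  answer := fun _ => true

theorem exists_min_rounds {n : ℕ} {p : MPCProtocol n → Prop} (h : ∃ P, p P) :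
    ∃ P, p P ∧ ∀ P', p P' → P.rounds ≤ P'.rounds := by
  obtain ⟨P, hP, hmin⟩ := (measure fun P : MPCProtocol n => P.rounds).wf.has_min {P | p P} h
  exact ⟨P, hP, fun P' hP' => not_lt.1 (hmin P' hP')⟩

/-- The conjecture is applied to the family that has, for each `n`, the fewest rounds among the
bounded protocols; its lower bound then holds for all of them. Where no bounded protocol exists, the
trivial one fills in; its word size `n` obeys the bound by `hγ` and `hB`. -/
theorem OneCycleVersusTwoCycleConjecture.uniform (h : OneCycleVersusTwoCycleConjecture)
    {δ : ℝ} (hδ₀ : 0 < δ) (hδ₁ : δ < 1) {γ : ℕ} (hγ : γ ≠ 0) {B : ℝ} (hB : 1 ≤ B)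
    (hex : ∀ n, 6 ≤ n → Even n → ∃ P : MPCProtocol n, P.IsBounded δ γ B) :
    ∃ c : ℝ, 0 < c ∧ ∃ n₀ : ℕ, ∀ n, n₀ ≤ n → Even n → ∀ P : MPCProtocol n,
      P.IsBounded δ γ B → c * Real.log n ≤ P.rounds := by
  classical
  have key : ∀ n, ∃ P : MPCProtocol n, ((∃ P' : MPCProtocol n, P'.IsBounded δ γ B) →
      P.IsBounded δ γ B ∧ ∀ P' : MPCProtocol n, P'.IsBounded δ γ B → P.rounds ≤ P'.rounds) ∧
      ((¬ ∃ P' : MPCProtocol n, P'.IsBounded δ γ B) → P = trivialProtocol n) := by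
    intro n
    by_cases hP : ∃ P' : MPCProtocol n, P'.IsBounded δ γ B
    · obtain ⟨P, hP'⟩ := exists_min_rounds hP
      exact ⟨P, fun _ => hP', fun h => absurd hP h⟩
    · exact ⟨_, fun h => absurd h hP, fun _ => rfl⟩
  choose P hP₁ hP₂ using key
  have hbounds : ∀ n, 1 ≤ n → ((P n).memory : ℝ) ≤ B * (n : ℝ) ^ δ ∧
      (Fintype.card (P n).Machine : ℝ) ≤ B * (n : ℝ) ^ γ ∧
      ((P n).wordSize : ℝ) ≤ B * (n : ℝ) ^ γ := by
    intro n hn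
    have hn' : (1 : ℝ) ≤ n := by exact_mod_cast hn
    by_cases hP : ∃ P' : MPCProtocol n, P'.IsBounded δ γ B
    · exact (hP₁ n hP).1.2
    · rw [hP₂ n hP]
      have hpow : (n : ℝ) ≤ (n : ℝ) ^ γ := le_self_pow₀ hn' hγ
      refine ⟨?_, ?_, ?_⟩
      · change ((0 : ℕ) : ℝ) ≤ _
        rw [Nat.cast_zero]
        positivity
      · have : Fintype.card (trivialProtocol n).Machine = 1 := Fintype.card_unit
        rw [this, Nat.cast_one]
        nlinarith
      · change (n : ℝ) ≤ _
        nlinarith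
  have hO : ∀ f g : ℕ → ℝ, (∀ n, 0 ≤ f n) → (∀ n, 0 ≤ g n) → (∀ n, 1 ≤ n → f n ≤ B * g n) →
      f =O[atTop] g := by
    intro f g hf hg hfg
    refine IsBigO.of_bound B ?_
    filter_upwards [eventually_ge_atTop 1] with n hn
    rw [Real.norm_of_nonneg (hf n), Real.norm_of_nonneg (hg n)]
    exact hfg n hn
  have hmain := h δ γ P hδ₀ hδ₁
    (hO _ _ (fun _ => by positivity) (fun _ => by positivity) fun n hn => (hbounds n hn).1)
    (hO _ _ (fun _ => by positivity) (fun _ => by positivity) fun n hn => (hbounds n hn).2.1)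
    (hO _ _ (fun _ => by positivity) (fun _ => by positivity) fun n hn => (hbounds n hn).2.2)
    (fun n hn hn' => (hP₁ n (hex n hn hn')).1.1)
  obtain ⟨K, hK⟩ := isBigO_iff.1 hmain
  rw [eventually_inf_principal, eventually_atTop] at hK
  obtain ⟨n₀, hn₀⟩ := hK
  have hK' : 0 < max K 1 := lt_max_of_lt_right one_pos
  -- The constant `K` of the asymptotic bound need not be positive.
  refine ⟨(max K 1)⁻¹, inv_pos.2 hK', n₀, fun n hn hn' P' hP' => ?_⟩
  rw [inv_mul_le_iff₀ hK']
  have h₁ := hn₀ n hn hn'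
  rw [Real.norm_of_nonneg (Real.log_natCast_nonneg n), Real.norm_of_nonneg (Nat.cast_nonneg _)]
    at h₁
  have h₂ : ((P n).rounds : ℝ) ≤ P'.rounds := by exact_mod_cast (hP₁ n ⟨P', hP'⟩).2 P' hP'
  calc Real.log n ≤ K * (P n).rounds := h₁
    _ ≤ max K 1 * (P n).rounds := by gcongr; exact le_max_left _ _
    _ ≤ max K 1 * P'.rounds := by gcongr

/-! ## The choice of parameters -/

/-- The base is the fan-in `d` used throughout; the summand `3` guarantees `3 ≤ d`, needed to join
three values in one node. -/
theorem le_ceil_rpow_pow {ε : ℝ} (hε : 0 < ε) {E : ℕ} (hE : 2 / ε ≤ E) {n : ℕ} (hn : 1 ≤ n) :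
    n ≤ (⌈(n : ℝ) ^ (ε / 2)⌉₊ + 3) ^ E := by
  have hn' : (1 : ℝ) ≤ n := by exact_mod_cast hn
  rw [← Nat.cast_le (α := ℝ)]
  push_cast
  calc (n : ℝ) = (n : ℝ) ^ (1 : ℝ) := (Real.rpow_one _).symm
    _ ≤ (n : ℝ) ^ (ε / 2 * E) := by
      refine Real.rpow_le_rpow_of_exponent_le hn' ?_
      rw [div_le_iff₀ hε] at hE
      linarith
    _ = ((n : ℝ) ^ (ε / 2)) ^ E := by rw [Real.rpow_mul (by positivity), Real.rpow_natCast]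
    _ ≤ _ := by
      gcongr
      linarith [Nat.le_ceil ((n : ℝ) ^ (ε / 2))]

theorem ceil_rpow_add_three_le {ε : ℝ} (hε : 0 < ε) {n : ℕ} (hn : 1 ≤ n) :
    ((⌈(n : ℝ) ^ (ε / 2)⌉₊ + 3 : ℕ) : ℝ) ≤ 5 * (n : ℝ) ^ (ε / 2) := by
  have h₁ : (1 : ℝ) ≤ (n : ℝ) ^ (ε / 2) :=
    Real.one_le_rpow (by exact_mod_cast hn) (by positivity)
  have h₂ := Nat.ceil_lt_add_one (zero_le_one.trans h₁)
  push_cast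
  linarith

theorem sixteen_pow_le {C N p : ℕ} (hN : 1 ≤ N) (hp : (p : ℝ) ≤ C * Real.log N) :
    16 ^ p ≤ N ^ (3 * C) := by
  have hN' : (0 : ℝ) < N := by exact_mod_cast hN
  rw [← Nat.cast_le (α := ℝ)]
  push_cast
  have h16 : Real.log 16 ≤ 3 := by
    rw [show (16 : ℝ) = 2 ^ 4 by norm_num, Real.log_pow]
    have := Real.log_two_lt_d9
    norm_num
    linarith
  rw [← Real.log_le_log_iff (by positivity) (by positivity), Real.log_pow, Real.log_pow]
  push_cast
  have hlog : 0 ≤ Real.log N := Real.log_natCast_nonneg N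
  calc (p : ℝ) * Real.log 16 ≤ p * 3 := by gcongr
    _ ≤ C * Real.log N * 3 := by gcongr
    _ = _ := by ring

/-- The number of edges of the cycles from which the hard graphs with parameters `N`, `k` are
obtained by subdivision. -/
theorem exists_even_size {ε : ℝ} {C N k : ℕ} (hk : 1 ≤ k)
    (hkN : (k : ℝ) ≤ C * (N : ℝ) ^ (1 - ε)) (hN : 1 ≤ N) (hC : 48 * (C : ℝ) ≤ (N : ℝ) ^ ε) :
    ∃ n : ℕ, Even n ∧ 6 ≤ n ∧ n * (2 * k + 2) ≤ N ∧ (N : ℝ) / (8 * k) ≤ n ∧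
      (N : ℝ) ^ ε ≤ 8 * C * n := by
  have hN' : (0 : ℝ) < N := by exact_mod_cast hN
  have hk' : (1 : ℝ) ≤ k := by exact_mod_cast hk
  have hmul : (N : ℝ) ^ (1 - ε) * (N : ℝ) ^ ε = N := by
    rw [← Real.rpow_add hN', sub_add_cancel, Real.rpow_one]
  -- This gives `N / (8 * k) ≥ 6`, hence `n ≥ 6`.
  have h48 : 48 * (k : ℝ) ≤ N := by
    calc 48 * (k : ℝ) ≤ 48 * (C * (N : ℝ) ^ (1 - ε)) := by gcongr
      _ = (N : ℝ) ^ (1 - ε) * (48 * C) := by ring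
      _ ≤ (N : ℝ) ^ (1 - ε) * (N : ℝ) ^ ε := by gcongr
      _ = N := hmul
  have h48' : 48 * k ≤ N := by exact_mod_cast h48
  have hq : N < 2 * (2 * k + 2) * (N / (2 * (2 * k + 2)) + 1) := Nat.lt_mul_div_succ N (by omega)
  have hq' : 2 * (2 * k + 2) * (N / (2 * (2 * k + 2))) ≤ N := Nat.mul_div_le N _
  set q := N / (2 * (2 * k + 2)) with hq_def
  have hn : (N : ℝ) / (8 * k) ≤ (2 * q : ℕ) := by
    have hq_real : (N : ℝ) < 2 * (2 * k + 2) * (q + 1) := by exact_mod_cast hq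
    rw [div_le_iff₀ (by positivity)]
    push_cast
    have : (q : ℝ) * 1 ≤ q * k := by gcongr
    nlinarith
  refine ⟨2 * q, even_two_mul q, ?_, ?_, hn, ?_⟩
  · have : (6 : ℝ) ≤ (2 * q : ℕ) := by
      refine le_trans ?_ hn
      rw [le_div_iff₀ (by positivity)]
      linarith
    exact_mod_cast this
  · calc 2 * q * (2 * k + 2) = 2 * (2 * k + 2) * q := by ring
      _ ≤ N := hq'
  · rw [div_le_iff₀ (by positivity)] at hn
    have hpos : 0 < (N : ℝ) ^ (1 - ε) := by positivity
    refine le_of_mul_le_mul_left ?_ hpos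
    rw [hmul]
    calc (N : ℝ) ≤ (2 * q : ℕ) * (8 * k) := hn
      _ ≤ (2 * q : ℕ) * (8 * (C * (N : ℝ) ^ (1 - ε))) := by gcongr
      _ = _ := by ring

theorem exists_isBounded_protocol {ε : ℝ} (hε₀ : 0 < ε) (hε₁ : ε < 1) {E a γ₁ γ : ℕ}
    (hE : 2 / ε ≤ E) (hEa : E ≤ a) (hγ₁ : a + (1 + a + 1) + (a + (1 + a + 1) + 1) ≤ γ₁)
    (hγ : γ₁ ≤ γ) (n : ℕ) (hn : 6 ≤ n) :
    ∃ P : MPCProtocol n, P.IsBounded (1 - ε / 2) γ (10 * 5 ^ γ₁) := by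
  set d := ⌈(n : ℝ) ^ (ε / 2)⌉₊ + 3 with hd
  have hn' : (1 : ℝ) ≤ n := by exact_mod_cast (by omega : 1 ≤ n)
  have hd₁ : (d : ℝ) ≤ 5 * (n : ℝ) ^ (ε / 2) := ceil_rpow_add_three_le hε₀ (by omega)
  have hd₅ : (d : ℝ) ≤ 5 * n := by
    refine hd₁.trans ?_
    gcongr
    calc (n : ℝ) ^ (ε / 2) ≤ (n : ℝ) ^ (1 : ℝ) :=
          Real.rpow_le_rpow_of_exponent_le hn' (by linarith)
      _ = n := Real.rpow_one _
  have hnd : n ≤ d ^ a :=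
    (le_ceil_rpow_pow hε₀ hE (by omega)).trans (Nat.pow_le_pow_right (by omega) hEa)
  have h5 : (1 : ℝ) ≤ 5 ^ γ₁ := one_le_pow₀ (by norm_num)
  obtain ⟨P, hP, h₁, h₂, h₃⟩ := exists_protocol_of_small_memory (W := 2 * n ^ 2)
    (D' := a + (1 + a + 1) + 1) (by omega) (by omega : 2 ≤ d) hnd le_rfl (by
      rw [add_assoc a, pow_add d a]
      exact Nat.mul_le_mul_right _ hnd)
  refine ⟨P, hP, ?_, ?_, ?_⟩
  · rw [h₃]
    calc (d : ℝ) ≤ 5 * (n : ℝ) ^ (ε / 2) := hd₁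
      _ ≤ 5 * (n : ℝ) ^ (1 - ε / 2) := by
        gcongr
        linarith
      _ ≤ 10 * 5 ^ γ₁ * (n : ℝ) ^ (1 - ε / 2) := by
        gcongr
        linarith
  · rw [h₁]
    have : n * d ^ (1 + a + 1) * d ^ (a + (1 + a + 1) + 1) ≤ d ^ γ₁ := by
      calc n * d ^ (1 + a + 1) * d ^ (a + (1 + a + 1) + 1)
          ≤ d ^ a * d ^ (1 + a + 1) * d ^ (a + (1 + a + 1) + 1) := by gcongr
        _ = d ^ (a + (1 + a + 1) + (a + (1 + a + 1) + 1)) := by rw [← pow_add, ← pow_add]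
        _ ≤ d ^ γ₁ := Nat.pow_le_pow_right (by omega) hγ₁
    calc ((n * d ^ (1 + a + 1) * d ^ (a + (1 + a + 1) + 1) : ℕ) : ℝ) ≤ (d : ℝ) ^ γ₁ := by
          exact_mod_cast this
      _ ≤ (5 * n) ^ γ₁ := by gcongr
      _ = 5 ^ γ₁ * (n : ℝ) ^ γ₁ := mul_pow _ _ _
      _ ≤ 10 * 5 ^ γ₁ * (n : ℝ) ^ γ := by
        gcongr
        linarith
  · rw [h₂]
    push_cast
    have : 2 ≤ γ := by omega
    gcongr
    linarith

/-- The extra step that prepares the tokens turns `L` into `L + 1`; `h₃` absorbs it at the cost of a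
factor two. -/
theorem rounds_lower_bound {c₁ logn logN E K L : ℝ} (hc₁ : 0 < c₁) (hE : 0 < E) (hK : 0 < K)
    (h₁ : c₁ * logn ≤ (L + 1) * K) (h₂ : logN ≤ E * logn) (h₃ : 2 * E * K / c₁ ≤ logN) :
    c₁ / (2 * E * K) * logN ≤ L := by
  rw [div_le_iff₀ hc₁] at h₃
  rw [div_mul_eq_mul_div, div_le_iff₀ (by positivity)]
  have : c₁ * logN ≤ c₁ * (E * logn) := by gcongr
  have : E * (c₁ * logn) ≤ E * ((L + 1) * K) := by gcongr
  nlinarith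

/-- Written as `N / (8 * k) * N ^ (-ε)`, the bound on `m` is at most `n * n ^ (-ε)`, since `n ≤ N`.
-/
theorem width_le {ε : ℝ} (hε₀ : 0 < ε) {N n k : ℕ} {m : ℝ} (hk : 1 ≤ k) (hN : 1 ≤ N)
    (hn : 1 ≤ n) (hnN : n ≤ N) (h : (N : ℝ) / (8 * k) ≤ n)
    (hm : m ≤ 1 / 8 * ((N : ℝ) ^ (1 - ε) / k)) : m ≤ (n : ℝ) ^ (1 - ε) := by
  have hN' : (0 : ℝ) < N := by exact_mod_cast hN
  have hn' : (0 : ℝ) < n := by exact_mod_cast hn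
  have hk' : (0 : ℝ) < k := by exact_mod_cast hk
  have key : ∀ y : ℝ, 0 < y → y ^ (1 - ε) = y * y ^ (-ε) := by
    intro y hy
    rw [sub_eq_add_neg, Real.rpow_add hy, Real.rpow_one]
  calc m ≤ 1 / 8 * ((N : ℝ) ^ (1 - ε) / k) := hm
    _ = N / (8 * k) * (N : ℝ) ^ (-ε) := by
      rw [key _ hN']
      field_simp
    _ ≤ n * (N : ℝ) ^ (-ε) := by gcongr
    _ ≤ n * (n : ℝ) ^ (-ε) := by
      exact mul_le_mul_of_nonneg_left
        (Real.rpow_le_rpow_of_nonpos hn' (by exact_mod_cast hnN) (by linarith)) hn'.le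
    _ = (n : ℝ) ^ (1 - ε) := (key _ hn').symm

theorem wordSize_bounds {N C T m H P n : ℕ} (hN : 7 ≤ N) (hT : T ≤ N ^ (C + 1))
    (hm : m ≤ N ^ (C + 1)) (hH : H ≤ N ^ (C + 1)) (hP : P ≤ N ^ (3 * C)) (hn : n ≤ N) :
    2 * ((T + m + H) * P) + 1 ≤ N ^ (4 * C + 16) ∧ (n ^ 3 + 1) ^ 4 ≤ N ^ (4 * C + 16) := by
  constructor
  · have h1 : 1 ≤ N ^ (4 * C + 1) := Nat.one_le_pow _ _ (by omega)
    calc 2 * ((T + m + H) * P) + 1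
        ≤ 2 * ((N ^ (C + 1) + N ^ (C + 1) + N ^ (C + 1)) * N ^ (3 * C)) + 1 := by gcongr
      _ = 6 * N ^ (4 * C + 1) + 1 := by ring
      _ ≤ 7 * N ^ (4 * C + 1) := by omega
      _ ≤ N * N ^ (4 * C + 1) := by gcongr
      _ = N ^ (4 * C + 2) := by ring
      _ ≤ N ^ (4 * C + 16) := Nat.pow_le_pow_right (by omega) (by omega)
  · have h3 : n ^ 3 ≤ N ^ 3 := Nat.pow_le_pow_left hn 3
    have h1 : 1 ≤ N ^ 3 := Nat.one_le_pow _ _ (by omega)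
    calc (n ^ 3 + 1) ^ 4 ≤ (N ^ 4) ^ 4 := by
          refine Nat.pow_le_pow_left ?_ 4
          calc n ^ 3 + 1 ≤ 7 * N ^ 3 := by omega
            _ ≤ N * N ^ 3 := by gcongr
            _ = N ^ 4 := by ring
      _ = N ^ 16 := by rw [← pow_mul]
      _ ≤ N ^ (4 * C + 16) := Nat.pow_le_pow_right (by omega) (by omega)

/-! ### The trade-off between depth and width -/

theorem mainTheorem12 (hconj : OneCycleVersusTwoCycleConjecture)
    (ε : ℝ) (hε₀ : 0 < ε) (hε₁ : ε < 1) (C : ℕ) :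
    ∃ c : ℝ, 0 < c ∧ ∃ N₀ : ℕ, ∀ N : ℕ, N₀ ≤ N →
      ∀ k p m L H : ℕ, 1 ≤ k → (k : ℝ) ≤ C * (N : ℝ) ^ (1 - ε) →
        (p : ℝ) ≤ C * Real.log N → H ≤ C * N ^ C →
        ∀ A : LocalTransformer k p m L H,
          (∀ v ≤ N, A.numTokens v ≤ C * N ^ C) →
          A.SolvesConnectivity N →
          c * Real.log N ≤ L ∨ c * ((N : ℝ) ^ (1 - ε) / k) ≤ m := by
  obtain ⟨E, hE⟩ := exists_nat_ge (2 / ε)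
  have hE0 : 0 < E := by
    have : (0 : ℝ) < E := lt_of_lt_of_le (by positivity) hE
    exact_mod_cast this
  -- From `N ≤ n ^ E` and `n ≤ d ^ E` follows `N ^ (C + 2) ≤ d ^ a`, so trees of depth `a` cover all
  -- edges, tokens and heads.
  obtain ⟨a, ha⟩ : ∃ a, a = E * E * (C + 2) := ⟨_, rfl⟩
  obtain ⟨D, hD⟩ : ∃ D, D = 1 + a + 1 + a + a + 1 := ⟨_, rfl⟩
  obtain ⟨D', hD'⟩ : ∃ D', D' = a + (D + 1) := ⟨_, rfl⟩
  obtain ⟨γ₁, hγ₁⟩ : ∃ γ₁, γ₁ = a + D + D' := ⟨_, rfl⟩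
  -- The part `γ₁` accounts for the number of machines, the rest for the word size `N ^ (4 * C +
  -- 16)`.
  obtain ⟨γ, hγ⟩ : ∃ γ, γ = γ₁ + E * (4 * C + 16) := ⟨_, rfl⟩
  have hEa : E ≤ a := by
    rw [ha, mul_assoc]
    exact Nat.le_mul_of_pos_right _ (by positivity)
  have h5 : (1 : ℝ) ≤ 5 ^ γ₁ := one_le_pow₀ (by norm_num)
  obtain ⟨c₁, hc₁, n₀, hn₀⟩ := hconj.uniform (δ := 1 - ε / 2) (γ := γ) (B := 10 * 5 ^ γ₁)
    (by linarith) (by linarith) (by omega) (by linarith)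
    fun n hn _ => exists_isBounded_protocol hε₀ hε₁ hE hEa (by omega) (by omega) n hn
  set K : ℝ := (D + 1) * (D' + 1) with hK
  have hK0 : 0 < K := by positivity
  have hER : (0 : ℝ) < E := by exact_mod_cast hE0
  have hlarge : ∀ᶠ N : ℕ in atTop, 7 ≤ N ∧ C ≤ N ∧ 48 * (C : ℝ) ≤ (N : ℝ) ^ ε ∧
      8 * (C : ℝ) * n₀ ≤ (N : ℝ) ^ ε - 1 ∧ 8 * (C : ℝ) ≤ (N : ℝ) ^ (ε / 2) ∧
      2 * E * K / c₁ ≤ Real.log N := by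
    have h₁ : Tendsto (fun N : ℕ => (N : ℝ) ^ ε) atTop atTop :=
      (tendsto_rpow_atTop hε₀).comp tendsto_natCast_atTop_atTop
    have h₂ : Tendsto (fun N : ℕ => (N : ℝ) ^ (ε / 2)) atTop atTop :=
      (tendsto_rpow_atTop (half_pos hε₀)).comp tendsto_natCast_atTop_atTop
    have h₃ : Tendsto (fun N : ℕ => Real.log N) atTop atTop :=
      Real.tendsto_log_atTop.comp tendsto_natCast_atTop_atTop
    filter_upwards [eventually_ge_atTop 7, eventually_ge_atTop C, h₁.eventually_ge_atTop (48 * C),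
      h₁.eventually_ge_atTop (8 * C * n₀ + 1), h₂.eventually_ge_atTop (8 * C),
      h₃.eventually_ge_atTop (2 * E * K / c₁)] with N h1 h2 h3 h4 h5 h6
    exact ⟨h1, h2, h3, by linarith, h5, h6⟩
  obtain ⟨N₀, hN₀⟩ := eventually_atTop.1 hlarge
  refine ⟨min (1 / 8) (c₁ / (2 * E * K)), by positivity, N₀, fun N hN k p m L H hk hkN hp hH A hT hA
    => ?_⟩
  obtain ⟨hN7, hCN, h48, hNn₀, hN8, hlog⟩ := hN₀ N hN
  have hN1 : 1 ≤ N := by omega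
  have hNR : (0 : ℝ) < N := by exact_mod_cast hN1
  rw [or_iff_not_imp_right, not_le]
  intro hm
  obtain ⟨n, hneven, hn6, hnN, hNk, hNε⟩ := exists_even_size hk hkN hN1 h48
  have hnR : (1 : ℝ) ≤ n := by exact_mod_cast (by omega : 1 ≤ n)
  have hnN' : n ≤ N := (Nat.le_mul_of_pos_right n (by omega)).trans hnN
  have hC0 : 0 < (C : ℝ) := by
    rcases Nat.eq_zero_or_pos C with rfl | hC
    · have : (1 : ℝ) ≤ k := by exact_mod_cast hk
      simp at hkN
      omega
    · exact_mod_cast hC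
  have hn₀n : n₀ ≤ n := by
    have : 8 * (C : ℝ) * n₀ ≤ 8 * C * n := by linarith
    exact_mod_cast le_of_mul_le_mul_left this (by positivity)
  -- Since `k ≤ C * N ^ (1 - ε)`, the cycle length `n` is at least `N ^ ε / (8 * C)`, hence at least
  -- `N ^ (ε / 2)`. So `log N` and `log n` agree up to a constant factor.
  have hNpow : N ≤ n ^ E := by
    have h₁ : (N : ℝ) ^ (ε / 2) ≤ n := by
      have : (N : ℝ) ^ (ε / 2) * (N : ℝ) ^ (ε / 2) ≤ (N : ℝ) ^ (ε / 2) * n := by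
        rw [← Real.rpow_add hNR, add_halves]
        exact hNε.trans (by gcongr)
      exact le_of_mul_le_mul_left this (by positivity)
    rw [← Nat.cast_le (α := ℝ)]
    push_cast
    calc (N : ℝ) = (N : ℝ) ^ (1 : ℝ) := (Real.rpow_one _).symm
      _ ≤ (N : ℝ) ^ (ε / 2 * E) := by
        refine Real.rpow_le_rpow_of_exponent_le (by exact_mod_cast hN1) ?_
        rw [div_le_iff₀ hε₀] at hE
        linarith
      _ = ((N : ℝ) ^ (ε / 2)) ^ E := by rw [Real.rpow_mul hNR.le, Real.rpow_natCast]
      _ ≤ (n : ℝ) ^ E := by gcongr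
  have hmn : (m : ℝ) ≤ (n : ℝ) ^ (1 - ε) := by
    refine width_le hε₀ hk hN1 (by omega) hnN' hNk (hm.le.trans ?_)
    gcongr
    exact min_le_left _ _
  have hmn' : m ≤ n := by
    rw [← Nat.cast_le (α := ℝ)]
    calc (m : ℝ) ≤ (n : ℝ) ^ (1 - ε) := hmn
      _ ≤ (n : ℝ) ^ (1 : ℝ) := Real.rpow_le_rpow_of_exponent_le hnR (by linarith)
      _ = n := Real.rpow_one _
  set d := ⌈(n : ℝ) ^ (ε / 2)⌉₊ + 3 with hd
  have hd₁ : (d : ℝ) ≤ 5 * (n : ℝ) ^ (ε / 2) := ceil_rpow_add_three_le hε₀ (by omega)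
  have hd₅ : (d : ℝ) ≤ 5 * n := by
    refine hd₁.trans ?_
    gcongr
    calc (n : ℝ) ^ (ε / 2) ≤ (n : ℝ) ^ (1 : ℝ) :=
          Real.rpow_le_rpow_of_exponent_le hnR (by linarith)
      _ = n := Real.rpow_one _
  have hNd : N ^ (C + 2) ≤ d ^ a := by
    calc N ^ (C + 2) ≤ (n ^ E) ^ (C + 2) := Nat.pow_le_pow_left hNpow _
      _ ≤ ((d ^ E) ^ E) ^ (C + 2) := by
        gcongr
        exact le_ceil_rpow_pow hε₀ hE (by omega)
      _ = d ^ a := by rw [ha, ← pow_mul, ← pow_mul, mul_assoc E E]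
  have hCN' : C * N ^ C ≤ N ^ (C + 1) := by
    rw [pow_succ']
    exact Nat.mul_le_mul_right _ hCN
  have hpowle : N ^ (C + 1) ≤ N ^ (C + 2) := Nat.pow_le_pow_right hN1 (by omega)
  have hNle : N ≤ N ^ (C + 1) := Nat.le_self_pow (by omega) N
  have hTN : A.numTokens (n * (2 * k + 2)) ≤ N ^ (C + 1) := (hT _ hnN).trans hCN'
  have hnT : n + A.numTokens (n * (2 * k + 2)) ≤ d ^ a := by
    refine le_trans ?_ hNd
    calc n + A.numTokens (n * (2 * k + 2)) ≤ N ^ (C + 1) + N ^ (C + 1) := by omega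
      _ = 2 * N ^ (C + 1) := by ring
      _ ≤ N * N ^ (C + 1) := Nat.mul_le_mul_right _ (by omega)
      _ = N ^ (C + 2) := by ring
  obtain ⟨hW, hW'⟩ := wordSize_bounds hN7 hTN (by omega : m ≤ _) (hH.trans hCN')
    (sixteen_pow_le hN1 hp) hnN'
  obtain ⟨P, hP, h₁, h₂, h₃, h₄⟩ := exists_protocol_of_localTransformer (d := d) (a := a) (b := a)
    (D' := D') (by omega) hnN A hA rfl (by omega) hW hW' (by omega) (by omega)
    (by omega) hD (by
      rw [hD', pow_add d a]
      exact Nat.mul_le_mul_right _ hnT)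
  -- The memory is `d * (m + 1) ≤ 5 * n ^ (ε / 2) * (2 * n ^ (1 - ε))`, which explains the exponent
  -- `1 - ε / 2` and the factor `10`.
  have hbounded : P.IsBounded (1 - ε / 2) γ (10 * 5 ^ γ₁) := by
    refine ⟨hP, ?_, ?_, ?_⟩
    · rw [h₃]
      push_cast
      have h1n : (1 : ℝ) ≤ (n : ℝ) ^ (1 - ε) := Real.one_le_rpow hnR (by linarith)
      calc (d : ℝ) * (m + 1) ≤ 5 * (n : ℝ) ^ (ε / 2) * (2 * (n : ℝ) ^ (1 - ε)) := by
            gcongr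
            linarith
        _ = 10 * ((n : ℝ) ^ (ε / 2) * (n : ℝ) ^ (1 - ε)) := by ring
        _ = 10 * (n : ℝ) ^ (1 - ε / 2) := by
          rw [← Real.rpow_add (by linarith)]
          ring_nf
        _ ≤ 10 * 5 ^ γ₁ * (n : ℝ) ^ (1 - ε / 2) := by
          gcongr
          linarith
    · rw [h₁]
      have : (n + A.numTokens (n * (2 * k + 2))) * d ^ D * d ^ D' ≤ d ^ γ₁ := by
        rw [hγ₁, pow_add, pow_add]
        gcongr
      calc (((n + A.numTokens (n * (2 * k + 2))) * d ^ D * d ^ D' : ℕ) : ℝ) ≤ (d : ℝ) ^ γ₁ := by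
            exact_mod_cast this
        _ ≤ (5 * n) ^ γ₁ := by gcongr
        _ = 5 ^ γ₁ * (n : ℝ) ^ γ₁ := mul_pow _ _ _
        _ ≤ 10 * 5 ^ γ₁ * (n : ℝ) ^ γ := by
          gcongr
          · linarith
          · omega
    · rw [h₂]
      have : N ^ (4 * C + 16) ≤ n ^ γ := by
        calc N ^ (4 * C + 16) ≤ (n ^ E) ^ (4 * C + 16) := Nat.pow_le_pow_left hNpow _
          _ = n ^ (E * (4 * C + 16)) := (pow_mul _ _ _).symm
          _ ≤ n ^ γ := Nat.pow_le_pow_right (by omega) (by omega)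
      calc ((N ^ (4 * C + 16) : ℕ) : ℝ) ≤ (n : ℝ) ^ γ := by exact_mod_cast this
        _ ≤ 10 * 5 ^ γ₁ * (n : ℝ) ^ γ := by
          refine le_mul_of_one_le_left (by positivity) ?_
          linarith
  have hrounds := hn₀ n hn₀n hneven P hbounded
  rw [h₄] at hrounds
  push_cast at hrounds
  rw [mul_assoc] at hrounds
  have hlogN : Real.log N ≤ E * Real.log n := by
    rw [← Real.log_pow]
    exact Real.log_le_log hNR (by exact_mod_cast hNpow)
  refine le_trans ?_ (rounds_lower_bound hc₁ hER hK0 hrounds hlogN hlog)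
  gcongr
  exact min_le_right _ _
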